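/- **Setting.** Let $(\mathcal A,\succcurlyeq)$ be a finite poset; write $a\parallel b$ if $a,b$ are incomparable and $a\succ b$ if $a\succcurlyeq b$, $a\ne b$. A dueling bandit problem on this partially observable poset is a family $\gamma_{ij}\in(-\tfrac12,\tfrac12)$, $i,j\in\mathcal A$, with $\gamma_{ji}=-\gamma_{ij}$, with $\gamma_{ij}>0$ if and only if $i\succ j$, and with $\gamma_{ij}=0$ if $i\parallel j$. Every duel (pairwise comparison) of $i$ and $j$ is won by $i$ with probability $\tfrac12+\gamma_{ij}$, and by $j$ otherwise, independently of all other duels. Let $S\subseteq\mathcal A$ be a non-empty set of $K$ arms, let $\mathcal P=\{a\in S:\forall b\in S,\ a\succcurlyeq b\text{ or }a\parallel b\}$ be its Pareto front, and let $\mathrm{width}(S)$ be the size of its largest antichain. Let $\Delta>0$. For each $a\in S$ a new arm $a'\in\mathcal A\setminus S$ has been created, which is a $\Delta$-decoy of $a$: $a\succcurlyeq a'$ and $\gamma_{aa'}\ge\Delta$; for all $c\in S$, $c\parallel a$ implies $c\parallel a'$; for all $c\in S$, $c\succcurlyeq a$ implies $\gamma_{ca'}\ge\Delta$; moreover an arm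 $c\in S$ satisfies $c\succcurlyeq a'$ only if $c\succcurlyeq a$. **Confidence intervals.** For $\beta\in(0,1)$ and $\varepsilon>0$ put $n(\beta,\varepsilon)=\lceil 2\log(2/\beta)/\varepsilon^2\rceil$. After $w$ wins of $a$ in $k$ duels of $a$ against $b$, let $\hat p_{ab}=w/k$ and let the interval be $$I_{ab}=\Big\{p\in[0,1]: |w-kp|<\sqrt{\tfrac12\,n(\beta,\varepsilon)\log(2/\beta)}\Big\}$$ (so $I_{ab}=[0,1]$ if $k=0$). By Hoeffding's maximal inequality, with probability at least $1-\beta$ it contains $\tfrac12+\gamma_{ab}$ simultaneously for all $k\le n(\beta,\varepsilon)$. **Direct comparison** of $a,b$ with parameters $(\beta,\varepsilon)$. All previous duels of $a$ against $b$ are reused in $w$ and $k$, and an interval already maintained for the direct comparisons of this pair keeps the confidence parameter $\beta$ with which it was started. While $\tfrac12+\varepsilon\in I_{ab}$ or $\tfrac12-\varepsilon\in I_{ab}$: duel $a$ against $b$ and update; if $\tfrac12\notin I_{ab}$, return $a\succ b$ when $\hat p_{ab}>\tfrac12$ and $b\succ a$ when $\hat p_{ab}<\tfrac12$. When the loop ends,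 return $a\parallel b$. **Decoy comparison** of $a,b$ with parameters $(\beta,\Delta)$. Only new duels are used, and $I_{ab'}$, $I_{ba'}$ are formed with parameters $(\beta/2,\Delta)$. While $\tfrac12+\Delta\in I_{ab'}$ or $\tfrac12+\Delta\in I_{ba'}$: duel $a$ against $b'$ and $b$ against $a'$ and update; if $\tfrac12\notin I_{ab'}$ and $\hat p_{ab'}>\tfrac12$ return $a\succ b$; else if $\tfrac12\notin I_{ba'}$ and $\hat p_{ba'}>\tfrac12$ return $b\succ a$. When the loop ends, return $a\parallel b$. **Subroutine** on a set $S_t$ with error parameter $\delta'$ and a comparison method: take an initial pivot $p\in S_t$ and examine the other arms $c\in S_t$ one after the other. Compare $c$ with every current pivot, with $\beta=\delta'/|S_t|^2$; remove the pivots $c'$ for which $c\succ c'$ is returned; add $c$ to the pivots if $c'\succ c$ was returned for no pivot $c'$. Return the final set of pivots. **UnchainedBandits** with parameters $\delta\in(0,1)$, $\Delta>0$, $N\ge1$ and $(\varepsilon_t)_{t=1}^{N-1}$: put $S_1=S$; for $t=1,\dots,N-1$ let $S_{t+1}$ be the result of the subroutine on $S_t$ with error parameter $\delta/N$ and direct comparisons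 of precision $\varepsilon_t$; return the result of the subroutine on $S_N$ with error parameter $\delta/N$ and decoy comparisons. **Theorem.** There is a universal constant $C>0$ such that the following holds in this setting. Suppose that $(\varepsilon_t)_{t=1}^{N-1}$ is non-increasing and $\varepsilon_t\ge\Delta\sqrt{K/\mathrm{width}(S)}$ for all $1\le t\le N-1$. Then, for every rule that chooses the initial pivot and the order of examination from the epoch $t$ and the set $S_t$, with probability at least $1-\delta$ UnchainedBandits returns exactly $\mathcal P$ and does so after at most $$C\,\frac{K\,\mathrm{width}(S)\,\log(NK^2/\delta)}{\Delta^2}$$ duels in total. -/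

import Mathlib

noncomputable section

open scoped Classical

namespace UnchainedBandits

/-! ## Posets

The relation `a ≽ b` is written `b ≤ a`, and `a ∥ b` is `IncompRel (· ≤ ·) a b`. -/

/-- The Pareto front of a finite set `S` of arms: the arms `a` of `S` such that every `b ∈ S`
satisfies `a ≽ b` or `a ∥ b`. -/
def paretoFront {A : Type*} [PartialOrder A] (S : Finset A) : Finset A :=
  S.filter fun a => ∀ b ∈ S, b ≤ a ∨ IncompRel (· ≤ ·) a b

/-- The width of `S`: the size of its largest antichain. -/
def width {A : Type*} [PartialOrder A] (S : Finset A) : ℕ :=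
  (S.powerset.filter fun C : Finset A => IsAntichain (· ≤ ·) (C : Set A)).sup Finset.card

/-! ## Dueling bandits on partially observable posets -/

/-- A dueling bandit problem on a partially observable poset: `i` wins a duel against `j` with
probability `1/2 + γ i j`. -/
structure PosetBandit (A : Type*) [PartialOrder A] where
  γ : A → A → ℝ
  γ_mem : ∀ i j, γ i j ∈ Set.Ioo (-(1 / 2) : ℝ) (1 / 2)
  γ_swap : ∀ i j, γ j i = -γ i j
  order_compat : ∀ i j, j < i ↔ 0 < γ i j
  partially_observable : ∀ i j, IncompRel (· ≤ ·) i j → γ i j = 0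

/-- `b` is a `Δ`-decoy of `a`, relative to the set `S` of arms. -/
structure IsDecoy {A : Type*} [PartialOrder A] (B : PosetBandit A) (S : Finset A) (Δ : ℝ)
    (a b : A) : Prop where
  le : b ≤ a
  gap : Δ ≤ B.γ a b
  incomp : ∀ c ∈ S, IncompRel (· ≤ ·) a c → IncompRel (· ≤ ·) b c
  gap_of_le : ∀ c ∈ S, a ≤ c → Δ ≤ B.γ c b

/-- The decoys created for the arms of `S`: `d a` is a new arm, it is a `Δ`-decoy of `a`, and
it is dominated only by those arms of `S` that are `≽ a`. -/
structure CreatesDecoys {A : Type*} [PartialOrder A] (B : PosetBandit A) (S : Finset A) (Δ : ℝ)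
    (d : A → A) : Prop where
  isNew : ∀ a ∈ S, d a ∉ S
  isDecoy : ∀ a ∈ S, IsDecoy B S Δ a (d a)
  le_of_decoy_le : ∀ a ∈ S, ∀ c ∈ S, d a ≤ c → a ≤ c

/-- `X i j n ω` tells whether `i` wins the duel number `n` (counted from `0`) between `i` and `j`.
All the duels are independent; a duel between `i` and `j` is the same thing as a duel between
`j` and `i`, so independence is over unordered pairs and duel numbers. -/
structure IsDuelTable {A : Type*} [PartialOrder A] (B : PosetBandit A)
    {Ω : Type*} [MeasurableSpace Ω] (μ : MeasureTheory.Measure Ω)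
    (X : A → A → ℕ → Ω → Bool) : Prop where
  measurable : ∀ i j n, Measurable (X i j n)
  law : ∀ i j n, μ {ω | X i j n ω = true} = ENNReal.ofReal (1 / 2 + B.γ i j)
  swap : ∀ i j n ω, i ≠ j → X j i n ω = !(X i j n ω)
  indep : ProbabilityTheory.iIndepFun
    (fun (q : Sym2 A × ℕ) (ω : Ω) => X (Quot.out q.1).1 (Quot.out q.1).2 q.2 ω) μ

/-! ## Confidence intervals -/

/-- The number of duels after which Hoeffding's inequality gives, at confidence `1 - β`, an
interval of half-width at most `ε / 2`. -/
def horizon (β ε : ℝ) : ℕ := ⌈2 * Real.log (2 / β) / ε ^ 2⌉₊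

/-- The confidence interval, at level `1 - β` and for precision `ε`, for the probability of
winning, after `w` wins in `k` duels. With `n = horizon β ε` it is the set of all `p ∈ [0, 1]`
such that `|w / k - p| < √(n log (2 / β) / 2) / k`, and `[0, 1]` when `k = 0`. By the maximal form
of Hoeffding's inequality, with probability at least `1 - β` it contains the true value
simultaneously for all `k ≤ n`, and for `k = n` it is the usual Hoeffding interval. -/
def confInterval (β ε : ℝ) (k w : ℕ) : Set ℝ :=
  {p | p ∈ Set.Icc (0 : ℝ) 1 ∧ |(w : ℝ) - k * p| < √(horizon β ε * Real.log (2 / β) / 2)}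

/-! ## The comparison algorithms

They are run on one fixed table `x` of outcomes: `x i j n` tells whether `i` wins the duel
number `n` between `i` and `j`. -/

/-- The number of duels that `i` wins among the `k` duels with `j` that start at number `o`. -/
def wins {A : Type*} (x : A → A → ℕ → Bool) (i j : A) (o k : ℕ) : ℕ :=
  ((Finset.range k).filter fun n => x i j (o + n) = true).card

/-- The answer of a comparison of `a` with `b`: `a ≻ b`, `b ≻ a`, or indistinguishable. -/
inductive Verdict where
  | first
  | second
  | incomparable

/-- What the agent remembers: the number of duels played so far for each pair, and the confidence
parameter of the interval maintained for the direct comparisons of the pair, if there is one. -/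
structure Memory (A : Type*) where
  pulls : Sym2 A → ℕ
  level : Sym2 A → Option ℝ

/-- The memory at the beginning. -/
def Memory.empty (A : Type*) : Memory A := ⟨fun _ => 0, fun _ => none⟩

/-- The loop of the direct comparison. `W k` is the number of wins of the first arm in the first
`k` duels, and `k` is the current number of duels. It returns the verdict and the new number of
duels. (The loop ends by itself before `fuel` runs out when `fuel` is `horizon β ε`.) -/
def directLoop (β ε : ℝ) (W : ℕ → ℕ) : (fuel k : ℕ) → Verdict × ℕ
  | 0, k => (Verdict.incomparable, k)
  | fuel + 1, k =>
    if 1 / 2 + ε ∈ confInterval β ε k (W k) ∨ 1 / 2 - ε ∈ confInterval β ε k (W k) then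
      if (1 / 2 : ℝ) ∉ confInterval β ε (k + 1) (W (k + 1)) ∧
          (1 / 2 : ℝ) < (W (k + 1) : ℝ) / (k + 1 : ℕ) then
        (Verdict.first, k + 1)
      else if (1 / 2 : ℝ) ∉ confInterval β ε (k + 1) (W (k + 1)) ∧
          (W (k + 1) : ℝ) / (k + 1 : ℕ) < (1 / 2 : ℝ) then
        (Verdict.second, k + 1)
      else directLoop β ε W fuel (k + 1)
    else (Verdict.incomparable, k)

/-- Direct comparison of `a` and `b` at confidence `1 - β` and precision `ε`. The estimate and its
confidence interval are initialized with all the previous duels between `a` and `b`; an interval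
that is already maintained for the pair keeps its confidence parameter. -/
def directCompare {A : Type*} (x : A → A → ℕ → Bool) (ε β : ℝ) (m : Memory A) (a b : A) :
    Verdict × Memory A :=
  let β' := (m.level s(a, b)).getD β
  let r := directLoop β' ε (wins x a b 0) (horizon β' ε) (m.pulls s(a, b))
  (r.1, ⟨Function.update m.pulls s(a, b) r.2, Function.update m.level s(a, b) (some β')⟩)

/-- The loop of the decoy comparison. `W k` (resp. `W' k`) is the number of wins of `a` against the
decoy of `b` (resp. of `b` against the decoy of `a`) in the first `k` rounds, and `k` is the current
round. It returns the verdict and the number of rounds. (The loop ends by itself before `fuel`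
runs out when `fuel` is `horizon β ε`.) -/
def decoyLoop (β ε : ℝ) (W W' : ℕ → ℕ) : (fuel k : ℕ) → Verdict × ℕ
  | 0, k => (Verdict.incomparable, k)
  | fuel + 1, k =>
    if 1 / 2 + ε ∈ confInterval β ε k (W k) ∨ 1 / 2 + ε ∈ confInterval β ε k (W' k) then
      if (1 / 2 : ℝ) ∉ confInterval β ε (k + 1) (W (k + 1)) ∧
          (1 / 2 : ℝ) < (W (k + 1) : ℝ) / (k + 1 : ℕ) then
        (Verdict.first, k + 1)
      else if (1 / 2 : ℝ) ∉ confInterval β ε (k + 1) (W' (k + 1)) ∧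
          (1 / 2 : ℝ) < (W' (k + 1) : ℝ) / (k + 1 : ℕ) then
        (Verdict.second, k + 1)
      else decoyLoop β ε W W' fuel (k + 1)
    else (Verdict.incomparable, k)

/-- Decoy comparison of `a` and `b` at confidence `1 - β`, with decoys `d a` and `d b` of parameter
`Δ`: `a` duels with `d b` and `b` with `d a`, and each of the two intervals is at level
`1 - β / 2`. Only new duels are used. -/
def decoyCompare {A : Type*} (x : A → A → ℕ → Bool) (d : A → A) (Δ β : ℝ) (m : Memory A) (a b : A) :
    Verdict × Memory A :=
  let r := decoyLoop (β / 2) Δ (wins x a (d b) (m.pulls s(a, d b)))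
    (wins x b (d a) (m.pulls s(b, d a))) (horizon (β / 2) Δ) 0
  (r.1, ⟨fun e => m.pulls e + (if e = s(a, d b) then r.2 else 0) +
    (if e = s(b, d a) then r.2 else 0), m.level⟩)

/-! ## The subroutine and the algorithm -/

/-- Compare `c` with all the pivots. Returns the pivots that are not dominated by `c`, whether `c` is
dominated by none of the pivots, and the memory. -/
def examine {A : Type*} (cmp : Memory A → A → A → Verdict × Memory A) (c : A) :
    List A → Memory A → List A × Bool × Memory A
  | [], m => ([], true, m)
  | c' :: P, m =>
    let v := cmp m c c'
    let r := examine cmp c P v.2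
    match v.1 with
    | Verdict.first => r
    | Verdict.second => (c' :: r.1, false, r.2.2)
    | Verdict.incomparable => (c' :: r.1, r.2.1, r.2.2)

/-- The main loop of the subroutine: examine the listed arms one after the other, starting from
the pivots `P`. -/
def routineLoop {A : Type*} (cmp : Memory A → A → A → Verdict × Memory A) :
    List A → List A → Memory A → List A × Memory A
  | [], P, m => (P, m)
  | c :: cs, P, m =>
    let r := examine cmp c P m
    routineLoop cmp cs (if r.2.1 = true then r.1 ++ [c] else r.1) r.2.2

/-- The subroutine, on arms listed in the order of examination; the first one is the initial
pivot. It returns the final pivots and the memory. -/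
def ubsRoutine {A : Type*} (cmp : Memory A → A → A → Verdict × Memory A) :
    List A → Memory A → List A × Memory A
  | [], m => ([], m)
  | p :: cs, m => routineLoop cmp cs [p] m

/-- The peeling phase: the set of remaining arms and the memory after `t` epochs. The
order in which the arms of `S'` are examined in epoch `t` is `order t S'`. -/
def peel {A : Type*} (x : A → A → ℕ → Bool) (order : ℕ → Finset A → List A) (S : Finset A)
    (δ : ℝ) (N : ℕ) (ε : ℕ → ℝ) : ℕ → Finset A × Memory A
  | 0 => (S, Memory.empty A)
  | t + 1 =>
    let s := peel x order S δ N ε t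
    let r := ubsRoutine (directCompare x (ε (t + 1)) (δ / N / (s.1.card : ℝ) ^ 2))
      (order (t + 1) s.1) s.2
    (r.1.toFinset, r.2)

/-- `UnchainedBandits`: `N - 1` epochs of peeling, then one epoch with decoys. It returns the set of
final pivots and the memory. -/
def unchainedBandits {A : Type*} (x : A → A → ℕ → Bool) (order : ℕ → Finset A → List A)
    (d : A → A) (S : Finset A) (δ Δ : ℝ) (N : ℕ) (ε : ℕ → ℝ) : Finset A × Memory A :=
  let s := peel x order S δ N ε (N - 1)
  let r := ubsRoutine (decoyCompare x d Δ (δ / N / (s.1.card : ℝ) ^ 2)) (order N s.1) s.2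
  (r.1.toFinset, r.2)

/-- The total number of duels played. -/
def totalPulls {A : Type*} [Fintype A] (m : Memory A) : ℕ := ∑ e : Sym2 A, m.pulls e

end UnchainedBandits

end

section

open scoped Classical
open MeasureTheory ProbabilityTheory

/-! The argument separates a deterministic analysis on a fixed table of outcomes from a bound on the
probability of bad tables.

Correctness. When the relevant confidence intervals hold, a verdict `a ≻ b` is always true, so no
arm of the Pareto front is ever removed. Direct comparisons may return "incomparable" for arms with
a small gap, but decoy comparisons do not: if `b ≽ a`, then `b` beats the decoy of `a` by at least
`Δ`, which is detected within the horizon; and beating that decoy at all forces `b ≽ a`. The final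
pivots thus form an antichain that contains the front, and since every arm lies below a front arm,
they are the front (`unchainedBandits_correct`).

Cost. In the peeling phase duels are reused, so each pair of `S` is charged once, for the finest
precision used: at most `3 log(2/β) / ε_t² ≤ 3 log(2/β) width(S) / (K Δ²)` duels, times fewer than
`K²` pairs. In the decoy phase the current pivots are always pairwise incomparable, so there are at
most `width(S)` of them, and fewer than `K` arms are examined.

Probability. The pivots kept by an epoch have all been compared with one another, so their intervals
keep the level `δ/(N K²)` of the first epoch. Hence the events needed for peeling concern fixed
pairs, levels and precisions, and the maximal Hoeffding inequality with a union bound costs `δ/N`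
per epoch. The level of the decoy phase depends on the random set `S_N`; that set is determined by
finitely many duels inside `S`, which are independent of the duels against decoys, so one may
condition on its value and lose another `δ/N`. -/

namespace UnchainedBandits


/-! ### Maximal Hoeffding inequality, by Doob's inequality for exponentials of random walks. -/

section Hoeffding

variable {Ω : Type*} [MeasurableSpace Ω] {μ : Measure Ω} [IsProbabilityMeasure μ]

/-- The exponential of a centred random walk with exponential moments is a submartingale. -/
theorem submartingale_exp_partialSum {Z : ℕ → Ω → ℝ} (hm : ∀ i, StronglyMeasurable (Z i))
    (hind : iIndepFun Z μ) {v : NNReal} (hZ : ∀ i, HasSubgaussianMGF (Z i) v μ)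
    (hmean : ∀ i, ∫ ω, Z i ω ∂μ = 0) (l : ℝ) :
    Submartingale (fun k ω => Real.exp (l * ∑ i ∈ Finset.range (k + 1), Z i ω))
      (Filtration.natural Z hm) μ := by
  have hsum : ∀ k, HasSubgaussianMGF (fun ω => ∑ i ∈ Finset.range k, Z i ω)
      (∑ i ∈ Finset.range k, v) μ := fun k =>
    HasSubgaussianMGF.sum_of_iIndepFun hind fun i _ => hZ i
  have hadp : StronglyAdapted (Filtration.natural Z hm)
      (fun k ω => Real.exp (l * ∑ i ∈ Finset.range (k + 1), Z i ω)) := by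
    intro k
    refine Real.continuous_exp.comp_stronglyMeasurable (StronglyMeasurable.const_mul ?_ l)
    refine Finset.stronglyMeasurable_fun_sum _ fun i hi => ?_
    exact (Filtration.stronglyAdapted_natural hm i).mono
      ((Filtration.natural Z hm).mono (Nat.lt_succ_iff.mp (Finset.mem_range.mp hi)))
  refine submartingale_nat hadp (fun k => (hsum (k + 1)).integrable_exp_mul l) fun k => ?_
  have hsplit : (fun ω => Real.exp (l * ∑ i ∈ Finset.range (k + 1 + 1), Z i ω)) =
      (fun ω => Real.exp (l * ∑ i ∈ Finset.range (k + 1), Z i ω)) *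
        fun ω => Real.exp (l * Z (k + 1) ω) := by
    funext ω
    simp only [Pi.mul_apply]
    rw [Finset.sum_range_succ _ (k + 1), mul_add, Real.exp_add]
  have hE : Integrable (fun ω => Real.exp (l * Z (k + 1) ω)) μ :=
    (hZ (k + 1)).integrable_exp_mul l
  -- A centred increment gives a factor of mean at least `1`, by `exp x ≥ 1 + x`.
  have hone : 1 ≤ ∫ ω, Real.exp (l * Z (k + 1) ω) ∂μ := by
    have hi : Integrable (fun ω => l * Z (k + 1) ω + 1) μ :=
      ((hZ (k + 1)).integrable.const_mul l).add (integrable_const 1)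
    have h := integral_mono hi hE fun ω => Real.add_one_le_exp (l * Z (k + 1) ω)
    rw [integral_add ((hZ (k + 1)).integrable.const_mul l) (integrable_const 1),
      integral_const_mul, hmean] at h
    simpa using h
  have hcond : μ[fun ω => Real.exp (l * Z (k + 1) ω)|Filtration.natural Z hm k] =ᵐ[μ]
      fun _ => ∫ ω, Real.exp (l * Z (k + 1) ω) ∂μ := by
    have hmeas : Measurable fun x : ℝ => Real.exp (l * x) := by fun_prop
    refine condExp_indep_eq (m₁ := MeasurableSpace.comap (Z (k + 1)) inferInstance)
      ((hm (k + 1)).measurable.comap_le) ((Filtration.natural Z hm).le k)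
      (hmeas.comp (comap_measurable (Z (k + 1)))).stronglyMeasurable ?_
    exact hind.indep_comap_natural_of_lt hm (Nat.lt_succ_self k)
  rw [hsplit]
  have hmul := condExp_mul_of_stronglyMeasurable_left (μ := μ) (m := Filtration.natural Z hm k)
    (hadp k) (by rw [← hsplit]; exact (hsum (k + 1 + 1)).integrable_exp_mul l) hE
  filter_upwards [hmul, hcond] with ω h1 h2
  rw [h1, Pi.mul_apply, h2]
  exact le_mul_of_one_le_right (Real.exp_pos _).le hone

/-- The maximal form of Hoeffding's inequality. -/
theorem measureReal_exists_le_partialSum_le {Z : ℕ → Ω → ℝ} (hm : ∀ i, Measurable (Z i))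
    (hind : iIndepFun Z μ) {v : NNReal} (hv : 0 < v) (hZ : ∀ i, HasSubgaussianMGF (Z i) v μ)
    (hmean : ∀ i, ∫ ω, Z i ω ∂μ = 0) {n : ℕ} (hn : 0 < n) {c : ℝ} (hc : 0 < c) :
    μ.real {ω | ∃ k ≤ n, c ≤ ∑ i ∈ Finset.range k, Z i ω} ≤ Real.exp (-c ^ 2 / (2 * n * v)) := by
  obtain ⟨n, rfl⟩ : ∃ m, n = m + 1 := ⟨n - 1, by omega⟩
  -- This `l` minimizes the Chernoff exponent `n v l² / 2 - l c`.
  set l : ℝ := c / ((n + 1 : ℕ) * v) with hl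
  have hv' : (0 : ℝ) < v := hv
  have hl0 : 0 < l := by positivity
  have hsm : ∀ i, StronglyMeasurable (Z i) := fun i => (hm i).stronglyMeasurable
  set f : ℕ → Ω → ℝ := fun k ω => Real.exp (l * ∑ i ∈ Finset.range (k + 1), Z i ω) with hf
  have hsub : Submartingale f (Filtration.natural Z hsm) μ :=
    submartingale_exp_partialSum hsm hind hZ hmean l
  set E : NNReal := ⟨Real.exp (l * c), (Real.exp_pos _).le⟩ with hE
  have hmax := maximal_ineq hsub (fun k ω => (Real.exp_pos _).le) (ε := E) n
  set M := {ω | (E : ℝ) ≤ (Finset.range (n + 1)).sup' Finset.nonempty_range_add_one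
    fun k => f k ω} with hM
  have hsubset : {ω | ∃ k ≤ n + 1, c ≤ ∑ i ∈ Finset.range k, Z i ω} ⊆ M := by
    rintro ω ⟨k, hk, hck⟩
    rcases k with _ | k
    · simp at hck; linarith
    · refine (Finset.le_sup'_iff (f := fun k => f k ω) _).mpr ⟨k, Finset.mem_range.mpr (Nat.lt_of_succ_le hk), ?_⟩
      exact Real.exp_le_exp.mpr (mul_le_mul_of_nonneg_left hck hl0.le)
  have hs : HasSubgaussianMGF (fun ω => ∑ i ∈ Finset.range (n + 1), Z i ω)
      (∑ i ∈ Finset.range (n + 1), v) μ :=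
    HasSubgaussianMGF.sum_of_iIndepFun hind fun i _ => hZ i
  have hint : ∫ ω in M, f n ω ∂μ ≤ Real.exp ((n + 1 : ℕ) * v * l ^ 2 / 2) := by
    refine (setIntegral_le_integral (hs.integrable_exp_mul l)
      (Filter.Eventually.of_forall fun ω => (Real.exp_pos _).le)).trans ?_
    simpa [mgf, NNReal.coe_sum] using hs.mgf_le l
  have hreal : Real.exp (l * c) * μ.real M ≤ Real.exp ((n + 1 : ℕ) * v * l ^ 2 / 2) := by
    have h := ENNReal.toReal_mono ENNReal.ofReal_ne_top hmax
    rw [ENNReal.toReal_mul, ENNReal.toReal_ofReal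
      (integral_nonneg fun ω => (Real.exp_pos _).le)] at h
    exact (le_of_eq rfl).trans (h.trans hint)
  refine (measureReal_mono hsubset).trans ?_
  rw [mul_comm, ← le_div_iff₀ (Real.exp_pos _), ← Real.exp_sub] at hreal
  refine hreal.trans (Real.exp_le_exp.mpr (le_of_eq ?_))
  have hn' : ((n + 1 : ℕ) : ℝ) ≠ 0 := by positivity
  rw [hl]
  field_simp
  ring

end Hoeffding

/-- The radius, multiplied by the number of duels, of a confidence interval. -/
noncomputable def radius (β ε : ℝ) : ℝ := √(horizon β ε * Real.log (2 / β) / 2)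

theorem horizon_pos {β ε : ℝ} (hβ : 0 < β) (hβ1 : β < 1) (hε : 0 < ε) : 0 < horizon β ε := by
  have hL : 0 < Real.log (2 / β) := Real.log_pos (by rw [lt_div_iff₀ hβ]; linarith)
  exact Nat.ceil_pos.mpr (by positivity)

theorem radius_pos {β ε : ℝ} (hβ : 0 < β) (hβ1 : β < 1) (hε : 0 < ε) : 0 < radius β ε := by
  have hL : 0 < Real.log (2 / β) := Real.log_pos (by rw [lt_div_iff₀ hβ]; linarith)
  have hn : (0 : ℝ) < horizon β ε := by exact_mod_cast horizon_pos hβ hβ1 hε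
  exact Real.sqrt_pos.mpr (by positivity)

theorem wins_swap {A : Type*} {x : A → A → ℕ → Bool} {i j : A} (h : ∀ n, x j i n = !(x i j n)) (o k : ℕ) :
    (wins x j i o k : ℝ) = k - wins x i j o k := by
  have h1 := Finset.card_filter_add_card_filter_not (s := Finset.range k)
    (fun n => x i j (o + n) = true)
  have h2 : wins x j i o k = ((Finset.range k).filter fun n => ¬ x i j (o + n) = true).card := by
    simp [wins, h]
  have h3 : wins x i j o k + wins x j i o k = k := by
    rw [h2]
    simpa [wins] using h1
  have h4 : (wins x i j o k : ℝ) + wins x j i o k = k := by exact_mod_cast h3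
  linarith

/-! ### Independence and concentration of the duels. -/

section Tables

variable {A : Type*} [PartialOrder A] {B : PosetBandit A} {Ω : Type*} [MeasurableSpace Ω]
  {μ : Measure Ω} {X : A → A → ℕ → Ω → Bool}

theorem IsDuelTable.eq_or_eq_not (h : IsDuelTable B μ X) {i j : A} (hij : i ≠ j) (n : ℕ) (ω : Ω) :
    X (Quot.out s(i, j)).1 (Quot.out s(i, j)).2 n ω = X i j n ω ∧
        (Quot.out s(i, j)) = (i, j) ∨
      X (Quot.out s(i, j)).1 (Quot.out s(i, j)).2 n ω = (!(X i j n ω)) ∧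
        (Quot.out s(i, j)) = (j, i) := by
  have hq : s((Quot.out s(i, j)).1, (Quot.out s(i, j)).2) = s(i, j) := Quot.out_eq s(i, j)
  rcases Sym2.eq_iff.mp hq with ⟨h1, h2⟩ | ⟨h1, h2⟩
  · exact Or.inl ⟨by rw [h1, h2], Prod.ext h1 h2⟩
  · exact Or.inr ⟨by rw [h1, h2, h.swap i j n ω hij], Prod.ext h1 h2⟩

theorem IsDuelTable.iIndepFun_duels (h : IsDuelTable B μ X) {i j : A} (hij : i ≠ j) :
    iIndepFun (fun n ω => X i j n ω) μ := by
  have hinj : Function.Injective fun n : ℕ => (s(i, j), n) := fun a b hab => (Prod.ext_iff.mp hab).2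
  have h1 := h.indep.precomp hinj
  -- The representative of the unordered pair may be `(j, i)`. The outcome is then negated for every
  -- `n`, which preserves independence.
  have h2 := h1.comp (g := fun _ b => if Quot.out s(i, j) = (i, j) then b else !b)
    fun _ => measurable_from_top
  convert h2 using 2 with n
  funext ω
  simp only [Function.comp_apply]
  rcases h.eq_or_eq_not hij n ω with ⟨h3, h4⟩ | ⟨h3, h4⟩
  · rw [if_pos h4, h3]
  · rw [if_neg, h3, Bool.not_not]
    rw [h4]
    exact fun h5 => hij (Prod.ext_iff.mp h5).2

/-- Events that depend on disjoint finite sets of duels are independent. -/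
theorem IsDuelTable.measure_inter (h : IsDuelTable B μ X) {F G : Finset (Sym2 A × ℕ)}
    (hFG : Disjoint F G) {U V : Set Ω}
    (hU : ∀ ω ω', (∀ q ∈ F, X (Quot.out q.1).1 (Quot.out q.1).2 q.2 ω =
      X (Quot.out q.1).1 (Quot.out q.1).2 q.2 ω') → ω ∈ U → ω' ∈ U)
    (hV : ∀ ω ω', (∀ q ∈ G, X (Quot.out q.1).1 (Quot.out q.1).2 q.2 ω =
      X (Quot.out q.1).1 (Quot.out q.1).2 q.2 ω') → ω ∈ V → ω' ∈ V) :
    MeasurableSet U ∧ μ (U ∩ V) = μ U * μ V := by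
  have hmeas : ∀ q : Sym2 A × ℕ, Measurable fun ω => X (Quot.out q.1).1 (Quot.out q.1).2 q.2 ω :=
    fun q => h.measurable _ _ _
  have hi := h.indep.indepFun_finset F G hFG hmeas
  set f := fun ω (q : F) => X (Quot.out q.1.1).1 (Quot.out q.1.1).2 q.1.2 ω with hf
  set g := fun ω (q : G) => X (Quot.out q.1.1).1 (Quot.out q.1.1).2 q.1.2 ω with hg
  have hUf : U = f ⁻¹' (f '' U) := by
    refine Set.Subset.antisymm (Set.subset_preimage_image f U) ?_
    rintro ω ⟨ω', hω', he⟩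
    exact hU ω' ω (fun q hq => congrFun he ⟨q, hq⟩) hω'
  have hVg : V = g ⁻¹' (g '' V) := by
    refine Set.Subset.antisymm (Set.subset_preimage_image g V) ?_
    rintro ω ⟨ω', hω', he⟩
    exact hV ω' ω (fun q hq => congrFun he ⟨q, hq⟩) hω'
  rw [hUf, hVg]
  exact ⟨(measurable_pi_lambda f fun q => hmeas q.1) (Set.toFinite _).measurableSet,
    hi.measure_inter_preimage_eq_mul _ _ (Set.toFinite _).measurableSet
      (Set.toFinite _).measurableSet⟩

variable [IsProbabilityMeasure μ]

theorem IsDuelTable.measureReal_wins_ge_le (h : IsDuelTable B μ X) {i j : A} (hij : i ≠ j) {n : ℕ}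
    (hn : 0 < n) {c : ℝ} (hc : 0 < c) :
    μ.real {ω | ∃ k ≤ n, c ≤ wins (fun i j n => X i j n ω) i j 0 k - k * (1 / 2 + B.γ i j)} ≤
      Real.exp (-2 * c ^ 2 / n) := by
  set p : ℝ := 1 / 2 + B.γ i j with hp
  have hp0 : 0 ≤ p := by have := (B.γ_mem i j).1; rw [hp]; linarith
  set Y : ℕ → Ω → ℝ := fun n ω => if X i j n ω = true then 1 else 0 with hY
  have hset : ∀ n, MeasurableSet {ω | X i j n ω = true} := fun n =>
    h.measurable i j n (measurableSet_singleton true)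
  have hYm : ∀ n, Measurable (Y n) := fun n =>
    Measurable.ite (hset n) measurable_const measurable_const
  have hYE : ∀ n, ∫ ω, Y n ω ∂μ = p := by
    intro n
    have : Y n = Set.indicator {ω | X i j n ω = true} 1 := by
      funext ω
      simp [hY, Set.indicator_apply]
    rw [this, integral_indicator_one (hset n), measureReal_def, h.law i j n,
      ENNReal.toReal_ofReal hp0]
  have hsub : ∀ n, HasSubgaussianMGF (fun ω => Y n ω - p) (1 / 4) μ := by
    intro n
    have h1 := hasSubgaussianMGF_of_mem_Icc (μ := μ) (X := Y n) (a := 0) (b := 1)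
      (hYm n).aemeasurable (Filter.Eventually.of_forall fun ω => by
        simp only [hY]; split_ifs <;> simp)
    rw [hYE] at h1
    convert h1 using 1
    norm_num
  have hind : iIndepFun (fun n ω => Y n ω - p) μ :=
    (h.iIndepFun_duels hij).comp (fun _ b => (if b = true then (1 : ℝ) else 0) - p)
      fun _ => measurable_from_top
  have hmean : ∀ n, ∫ ω, (Y n ω - p) ∂μ = 0 := by
    intro n
    have hi : Integrable (Y n) μ := by
      -- A non-integrable function has integral `0`, whereas this one has integral `p > 0`.
      by_contra hni
      have h0 := integral_undef hni
      have := (B.γ_mem i j).1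
      rw [hYE] at h0
      linarith
    rw [integral_sub hi (integrable_const _), hYE]
    simp
  have key := measureReal_exists_le_partialSum_le (fun n => (hYm n).sub_const p) hind
    (by norm_num : (0 : NNReal) < 1 / 4) hsub hmean hn hc
  convert key using 1
  · congr 1
    ext ω
    have hw : ∀ k, (wins (fun i j n => X i j n ω) i j 0 k : ℝ) - k * p =
        ∑ i ∈ Finset.range k, (Y i ω - p) := by
      intro k
      rw [Finset.sum_sub_distrib]
      simp [wins, hY]
    simp only [Set.mem_ofPred_eq, hw]
  · congr 1
    push_cast
    field_simp
    norm_num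

theorem IsDuelTable.measureReal_not_mem_confInterval_le (h : IsDuelTable B μ X) {i j : A}
    (hij : i ≠ j) {β ε : ℝ} (hβ : 0 < β) (hβ1 : β < 1) (hε : 0 < ε) :
    μ.real {ω | ¬ ∀ k ≤ horizon β ε,
      |(wins (fun i j n => X i j n ω) i j 0 k : ℝ) - k * (1 / 2 + B.γ i j)| < radius β ε} ≤ β := by
  have hn := horizon_pos hβ hβ1 hε
  have hc := radius_pos hβ hβ1 hε
  have hL : 0 < Real.log (2 / β) := Real.log_pos (by rw [lt_div_iff₀ hβ]; linarith)
  -- The radius is such that each of the two tails has probability at most `β / 2`. The lower tail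
  -- of the wins of `i` is the upper tail of the wins of `j`.
  have hexp : Real.exp (-2 * radius β ε ^ 2 / horizon β ε) = β / 2 := by
    have hn' : (0 : ℝ) < horizon β ε := by exact_mod_cast hn
    rw [radius, Real.sq_sqrt (by positivity)]
    have : -2 * (horizon β ε * Real.log (2 / β) / 2) / horizon β ε = Real.log (β / 2) := by
      rw [← inv_div β 2, Real.log_inv]
      field_simp
    rw [this, Real.exp_log (by positivity)]
  have h1 := h.measureReal_wins_ge_le hij hn hc
  have h2 := h.measureReal_wins_ge_le hij.symm hn hc
  rw [hexp] at h1 h2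
  refine (measureReal_mono ?_).trans ((measureReal_union_le _ _).trans
    ((add_le_add h1 h2).trans (by linarith)))
  intro ω hω
  simp only [Set.mem_ofPred_eq, not_forall, not_lt] at hω
  obtain ⟨k, hk, hkc⟩ := hω
  rcases le_abs.mp hkc with h3 | h3
  · exact Or.inl ⟨k, hk, h3⟩
  · refine Or.inr ⟨k, hk, ?_⟩
    rw [wins_swap (fun n => h.swap i j n ω hij), B.γ_swap i j]
    linarith

end Tables


/-! ### Deterministic behaviour of the two comparison loops. -/

section Loops

variable {β ε : ℝ}

theorem mem_confInterval_iff {p : ℝ} (hp : p ∈ Set.Icc (0 : ℝ) 1) (k w : ℕ) :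
    p ∈ confInterval β ε k w ↔ |(w : ℝ) - k * p| < radius β ε :=
  and_iff_right hp

theorem half_mem_confInterval_iff (k w : ℕ) :
    (1 / 2 : ℝ) ∈ confInterval β ε k w ↔ |(w : ℝ) - k * (1 / 2)| < radius β ε :=
  mem_confInterval_iff (by norm_num) k w

theorem log_two_le_log_div (hβ : 0 < β) (hβ1 : β < 1) : Real.log 2 ≤ Real.log (2 / β) :=
  Real.log_le_log (by norm_num) (by rw [le_div_iff₀ hβ]; linarith)

/-- At the horizon the half-width is at most `ε / 2`, so the interval cannot contain both `1 / 2`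
and `1 / 2 ± ε`. This is what ends the loops. -/
theorem two_mul_radius_le (hβ : 0 < β) (hβ1 : β < 1) (hε : 0 < ε) :
    2 * radius β ε ≤ horizon β ε * ε := by
  have hL : 0 < Real.log (2 / β) := (Real.log_pos one_lt_two).trans_le (log_two_le_log_div hβ hβ1)
  have hn : 2 * Real.log (2 / β) / ε ^ 2 ≤ horizon β ε := Nat.le_ceil _
  rw [div_le_iff₀ (by positivity)] at hn
  have h : radius β ε ≤ horizon β ε * ε / 2 := by
    refine Real.sqrt_le_iff.mpr ⟨by positivity, ?_⟩
    have := mul_le_mul_of_nonneg_left hn (Nat.cast_nonneg (α := ℝ) (horizon β ε))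
    nlinarith
  linarith

/-- The ceiling adds at most `1`, which is absorbed by a third copy of `log (2 / β) / ε²` because
`log 2 ≥ 1 / 4 ≥ ε²`. -/
theorem horizon_le (hβ : 0 < β) (hβ1 : β < 1) (hε : 0 < ε) (hε2 : ε ≤ 1 / 2) :
    (horizon β ε : ℝ) ≤ 3 * Real.log (2 / β) / ε ^ 2 := by
  have hL := (Real.log_two_gt_d9).le.trans (log_two_le_log_div hβ hβ1)
  have h1 : (horizon β ε : ℝ) < 2 * Real.log (2 / β) / ε ^ 2 + 1 :=
    Nat.ceil_lt_add_one (by positivity)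
  have h2 : 1 ≤ Real.log (2 / β) / ε ^ 2 := by
    rw [one_le_div (by positivity)]
    nlinarith
  have h3 : 3 * Real.log (2 / β) / ε ^ 2 =
      2 * Real.log (2 / β) / ε ^ 2 + Real.log (2 / β) / ε ^ 2 := by ring
  linarith

theorem horizon_mono {ε' : ℝ} (hβ : 0 < β) (hβ1 : β < 1) (hε : 0 < ε') (h : ε' ≤ ε) :
    horizon β ε ≤ horizon β ε' := by
  have hL : 0 < Real.log (2 / β) := (Real.log_pos one_lt_two).trans_le (log_two_le_log_div hβ hβ1)
  exact Nat.ceil_mono (by gcongr)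

theorem radius_mono {ε' : ℝ} (hβ : 0 < β) (hβ1 : β < 1) (hε : 0 < ε') (h : ε' ≤ ε) :
    radius β ε ≤ radius β ε' := by
  have hL : 0 < Real.log (2 / β) := (Real.log_pos one_lt_two).trans_le (log_two_le_log_div hβ hβ1)
  have := horizon_mono hβ hβ1 hε h
  exact Real.sqrt_le_sqrt (by gcongr)

/-- The direct comparison stops within its horizon, it only depends on the duels within this
horizon, and its verdict tells on which side of the final confidence interval `1 / 2` lies. -/
theorem directLoop_spec (hβ : 0 < β) (hβ1 : β < 1) (hε : 0 < ε) {W W' : ℕ → ℕ}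
    (hW : ∀ k ≤ horizon β ε, W' k = W k) (fuel : ℕ) : ∀ k, k ≤ horizon β ε →
    horizon β ε ≤ k + fuel → |(W k : ℝ) - k * (1 / 2)| < radius β ε →
    directLoop β ε W' fuel k = directLoop β ε W fuel k ∧
    (directLoop β ε W fuel k).2 ≤ horizon β ε ∧
    (∀ b : ℝ, 3 * Real.log (2 / β) / ε ^ 2 ≤ b → (k : ℝ) ≤ b →
      ((directLoop β ε W fuel k).2 : ℝ) ≤ b) ∧
    ((directLoop β ε W fuel k).1 = Verdict.incomparable →
      |(W (directLoop β ε W fuel k).2 : ℝ) - (directLoop β ε W fuel k).2 * (1 / 2)| <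
        radius β ε) ∧
    ((directLoop β ε W fuel k).1 = Verdict.first → radius β ε ≤
      (W (directLoop β ε W fuel k).2 : ℝ) - (directLoop β ε W fuel k).2 * (1 / 2)) ∧
    ((directLoop β ε W fuel k).1 = Verdict.second → radius β ε ≤
      (directLoop β ε W fuel k).2 * (1 / 2) - (W (directLoop β ε W fuel k).2 : ℝ)) := by
  induction fuel with
  | zero =>
    intro k hk _ hin
    simp only [directLoop]
    exact ⟨trivial, hk, fun _ _ h => h, fun _ => hin, nofun, nofun⟩
  | succ fuel ih =>
    intro k hk hkf hin
    have hr := radius_pos hβ hβ1 hε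
    by_cases hc : 1 / 2 + ε ∈ confInterval β ε k (W k) ∨ 1 / 2 - ε ∈ confInterval β ε k (W k)
    -- For `ε > 1 / 2` neither point lies in `[0, 1]` and no duel is played. This is why the bound
    -- by `b` is stated relative to the initial count.
    · have hε2 : ε ≤ 1 / 2 := by
        rcases hc with h | h
        · linarith [h.1.2]
        · linarith [h.1.1]
      have hkn : k < horizon β ε := by
        refine lt_of_le_of_ne hk fun hkn => ?_
        have h2 := two_mul_radius_le hβ hβ1 hε
        rw [abs_lt] at hin
        rw [← hkn] at h2
        rcases hc with h | h
        · have := (abs_lt.mp h.2).1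
          change -radius β ε < _ at this
          nlinarith
        · have := (abs_lt.mp h.2).2
          change _ < radius β ε at this
          nlinarith
      have hb : ∀ b : ℝ, 3 * Real.log (2 / β) / ε ^ 2 ≤ b → ∀ l ≤ horizon β ε, (l : ℝ) ≤ b :=
        fun b hb l hl => (Nat.cast_le.mpr hl).trans ((horizon_le hβ hβ1 hε hε2).trans hb)
      have hk1 : (0 : ℝ) < (k + 1 : ℕ) := by positivity
      simp only [directLoop, hW k hk, hW (k + 1) hkn, if_pos hc, half_mem_confInterval_iff, not_lt,
        lt_div_iff₀ hk1, div_lt_iff₀ hk1]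
      by_cases h1 : radius β ε ≤ |(W (k + 1) : ℝ) - (k + 1 : ℕ) * (1 / 2)| ∧
          1 / 2 * ((k + 1 : ℕ) : ℝ) < W (k + 1)
      · simp only [if_pos h1]
        refine ⟨trivial, hkn, fun b h _ => hb b h _ hkn, nofun, fun _ => ?_, nofun⟩
        rw [abs_of_nonneg (by linarith [h1.2])] at h1
        exact h1.1
      by_cases h2 : radius β ε ≤ |(W (k + 1) : ℝ) - (k + 1 : ℕ) * (1 / 2)| ∧
          (W (k + 1) : ℝ) < 1 / 2 * ((k + 1 : ℕ) : ℝ)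
      · simp only [if_neg h1, if_pos h2]
        refine ⟨trivial, hkn, fun b h _ => hb b h _ hkn, nofun, nofun, fun _ => ?_⟩
        rw [abs_of_nonpos (by linarith [h2.2])] at h2
        linarith [h2.1]
      · simp only [if_neg h1, if_neg h2]
        have hin' : |(W (k + 1) : ℝ) - (k + 1 : ℕ) * (1 / 2)| < radius β ε := by
          by_contra! hge
          have h3 : ¬ 1 / 2 * ((k + 1 : ℕ) : ℝ) < W (k + 1) := fun h => h1 ⟨hge, h⟩
          have h4 : ¬ (W (k + 1) : ℝ) < 1 / 2 * ((k + 1 : ℕ) : ℝ) := fun h => h2 ⟨hge, h⟩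
          have h5 : (W (k + 1) : ℝ) - (k + 1 : ℕ) * (1 / 2) = 0 := by linarith
          rw [h5, abs_zero] at hge
          linarith
        obtain ⟨g1, g2, g3, g4⟩ := ih (k + 1) hkn (by omega) hin'
        exact ⟨g1, g2, fun b h _ => hb b h _ g2, g4⟩
    · simp only [directLoop, hW k hk, if_neg hc]
      exact ⟨trivial, hk, fun _ _ h => h, fun _ => hin, nofun, nofun⟩

/-- On correct confidence intervals, the decoy comparison stops within its horizon and separates
the gaps `≥ ε` from the gaps `≤ 0`. -/
theorem decoyLoop_spec (hβ : 0 < β) (hβ1 : β < 1) (hε : 0 < ε) (hε2 : ε ≤ 1 / 2) {W W' : ℕ → ℕ}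
    {g g' : ℝ} (hW : ∀ k ≤ horizon β ε, |(W k : ℝ) - k * (1 / 2 + g)| < radius β ε)
    (hW' : ∀ k ≤ horizon β ε, |(W' k : ℝ) - k * (1 / 2 + g')| < radius β ε) (fuel : ℕ) :
    ∀ k, k + fuel = horizon β ε → (W k : ℝ) - k * (1 / 2) < radius β ε →
    (W' k : ℝ) - k * (1 / 2) < radius β ε →
    (decoyLoop β ε W W' fuel k).2 ≤ horizon β ε ∧
    ((decoyLoop β ε W W' fuel k).1 = Verdict.incomparable → g < ε ∧ g' < ε) ∧
    ((decoyLoop β ε W W' fuel k).1 = Verdict.first → 0 < g) ∧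
    ((decoyLoop β ε W W' fuel k).1 = Verdict.second → 0 < g') := by
  induction fuel with
  | zero =>
    intro k hk h h'
    have h2 := two_mul_radius_le hβ hβ1 hε
    obtain rfl : k = horizon β ε := hk
    have hn : (0 : ℝ) < horizon β ε := by exact_mod_cast horizon_pos hβ hβ1 hε
    -- At the horizon, no win having been declared gives `n g < 2 radius ≤ n ε`.
    have small : ∀ {V : ℕ} {g : ℝ}, (V : ℝ) - horizon β ε * (1 / 2) < radius β ε →
        |(V : ℝ) - horizon β ε * (1 / 2 + g)| < radius β ε → g < ε := by
      intro V g h3 h4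
      have := (abs_lt.mp h4).1
      refine lt_of_mul_lt_mul_left (a := (horizon β ε : ℝ)) ?_ hn.le
      linarith
    simp only [decoyLoop]
    exact ⟨le_rfl, fun _ => ⟨small h (hW _ le_rfl), small h' (hW' _ le_rfl)⟩, nofun, nofun⟩
  | succ fuel ih =>
    intro k hk h h'
    have hr := radius_pos hβ hβ1 hε
    have hp : 1 / 2 + ε ∈ Set.Icc (0 : ℝ) 1 := ⟨by linarith, by linarith⟩
    by_cases hc : 1 / 2 + ε ∈ confInterval β ε k (W k) ∨ 1 / 2 + ε ∈ confInterval β ε k (W' k)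
    · have hk1 : (0 : ℝ) < (k + 1 : ℕ) := by positivity
      have pos : ∀ {V : ℕ} {g : ℝ}, radius β ε ≤ |(V : ℝ) - (k + 1 : ℕ) * (1 / 2)| ∧
          1 / 2 * ((k + 1 : ℕ) : ℝ) < V →
          |(V : ℝ) - (k + 1 : ℕ) * (1 / 2 + g)| < radius β ε → 0 < g := by
        intro V g h3 h4
        rw [abs_of_nonneg (by linarith [h3.2])] at h3
        have := (abs_lt.mp h4).2
        refine pos_of_mul_pos_right (a := ((k + 1 : ℕ) : ℝ)) ?_ hk1.le
        linarith [h3.1]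
      have inside : ∀ {V : ℕ}, ¬ (radius β ε ≤ |(V : ℝ) - (k + 1 : ℕ) * (1 / 2)| ∧
          1 / 2 * ((k + 1 : ℕ) : ℝ) < V) → (V : ℝ) - (k + 1 : ℕ) * (1 / 2) < radius β ε := by
        intro V h3
        by_contra! h4
        exact h3 ⟨h4.trans (le_abs_self _), by linarith⟩
      simp only [decoyLoop, if_pos hc, half_mem_confInterval_iff, not_lt, lt_div_iff₀ hk1]
      split_ifs with h1 h2
      · exact ⟨by simp only; omega, nofun, fun _ => pos h1 (hW _ (by omega)), nofun⟩
      · exact ⟨by simp only; omega, nofun, nofun, fun _ => pos h2 (hW' _ (by omega))⟩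
      · exact ih (k + 1) (by omega) (inside h1) (inside h2)
    · simp only [decoyLoop, if_neg hc]
      rw [not_or, mem_confInterval_iff hp, mem_confInterval_iff hp] at hc
      -- As `1 / 2` has not been exceeded by a full radius, `1 / 2 + ε` can only have left the
      -- interval from above. The true value, which is inside, is then below it.
      have small : ∀ {V : ℕ} {g : ℝ}, (V : ℝ) - k * (1 / 2) < radius β ε →
          ¬ |(V : ℝ) - k * (1 / 2 + ε)| < radius β ε →
          |(V : ℝ) - k * (1 / 2 + g)| < radius β ε → g < ε := by
        intro V g h3 h4 h5
        have hk0 : (0 : ℝ) ≤ k := Nat.cast_nonneg k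
        have h6 := (abs_lt.mp h5).1
        refine lt_of_mul_lt_mul_left (a := (k : ℝ)) ?_ hk0
        by_contra! h7
        exact h4 (abs_lt.mpr ⟨by linarith, by nlinarith⟩)
      exact ⟨by omega, fun _ => ⟨small h hc.1 (hW k (by omega)),
        small h' hc.2 (hW' k (by omega))⟩, nofun, nofun⟩

end Loops


/-! ### The subroutine, for an abstract comparison method. -/

section Routine

variable {A : Type*}

/-- What the subroutine needs to know about a comparison method `cmp` of the arms of `T`: it may
be applied to the pairs that are `Ready`, pairs are `Done` when found incomparable, a verdict
in favour of `a` against `b` means `dom a b`, and a comparison costs at most `M`.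
On the same pairs, the method `cmp'` gives the same results. -/
structure CompareSpec (T : Finset A) (cmp cmp' : Memory A → A → A → Verdict × Memory A)
    (Inv : Memory A → Prop) (Ready Done : Memory A → Sym2 A → Prop) (dom : A → A → Prop)
    (cost : Memory A → ℕ) (M : ℕ) : Prop where
  step : ∀ m a b, a ∈ T → b ∈ T → a ≠ b → Inv m → Ready m s(a, b) →
    cmp' m a b = cmp m a b ∧ Inv (cmp m a b).2 ∧ cost (cmp m a b).2 ≤ cost m + M ∧
    (∀ e, e ≠ s(a, b) → Ready m e → Ready (cmp m a b).2 e) ∧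
    (∀ e, e ≠ s(a, b) → Done m e → Done (cmp m a b).2 e) ∧
    ((cmp m a b).1 = Verdict.incomparable → Done (cmp m a b).2 s(a, b)) ∧
    ((cmp m a b).1 = Verdict.first → dom a b) ∧
    ((cmp m a b).1 = Verdict.second → dom b a)

variable {T : Finset A} {cmp cmp' : Memory A → A → A → Verdict × Memory A}
  {Inv : Memory A → Prop} {Ready Done : Memory A → Sym2 A → Prop} {dom : A → A → Prop}
  {cost : Memory A → ℕ} {M : ℕ}

/-- The pairs `{c, q}` are distinct, so comparing `c` with one pivot does not spoil the others. The
kept pivots are `Done` with `c` only if `c` survives: a pivot that beats `c` is kept too. -/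
theorem CompareSpec.examine (h : CompareSpec T cmp cmp' Inv Ready Done dom cost M) {c : A}
    (hc : c ∈ T) (P : List A) : ∀ m, P.Nodup → (∀ q ∈ P, q ∈ T) → c ∉ P → Inv m →
    (∀ q ∈ P, Ready m s(c, q)) →
    examine cmp' c P m = examine cmp c P m ∧
    Inv (examine cmp c P m).2.2 ∧
    cost (examine cmp c P m).2.2 ≤ cost m + M * P.length ∧
    (examine cmp c P m).1.Sublist P ∧
    (∀ e, (∀ q ∈ P, e ≠ s(c, q)) → Ready m e → Ready (examine cmp c P m).2.2 e) ∧
    (∀ e, (∀ q ∈ P, e ≠ s(c, q)) → Done m e → Done (examine cmp c P m).2.2 e) ∧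
    ((examine cmp c P m).2.1 = true →
      ∀ q ∈ (examine cmp c P m).1, Done (examine cmp c P m).2.2 s(c, q)) ∧
    (∀ q ∈ P, q ∉ (examine cmp c P m).1 → dom c q) ∧
    ((examine cmp c P m).2.1 = false → ∃ q ∈ P, dom q c) := by
  induction P with
  | nil =>
    intro m _ _ _ hI _
    simp [UnchainedBandits.examine, hI]
  | cons q P ih =>
    intro m hnd hT hcP hI hR
    obtain ⟨hqP, hnd⟩ := List.nodup_cons.mp hnd
    have hcq : c ≠ q := fun e => hcP (e ▸ List.mem_cons_self)
    have hcP' : c ∉ P := fun e => hcP (List.mem_cons_of_mem _ e)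
    have hne : ∀ q' ∈ P, s(c, q') ≠ s(c, q) := by
      intro q' hq' he
      rw [Sym2.congr_right] at he
      exact hqP (he ▸ hq')
    obtain ⟨s1, s2, s3, s4, s5, s6, s7, s8⟩ :=
      h.step m c q hc (hT q List.mem_cons_self) hcq hI (hR q List.mem_cons_self)
    obtain ⟨i1, i2, i3, i4, i5, i6, i7, i8, i9⟩ := ih (cmp m c q).2 hnd
      (fun q' hq' => hT q' (List.mem_cons_of_mem _ hq')) hcP' s2
      fun q' hq' => s4 _ (hne q' hq') (hR q' (List.mem_cons_of_mem _ hq'))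
    have hcost : cost (UnchainedBandits.examine cmp c P (cmp m c q).2).2.2 ≤
        cost m + M * (q :: P).length := by
      rw [List.length_cons, Nat.mul_succ]
      omega
    have hready : ∀ e, (∀ q' ∈ q :: P, e ≠ s(c, q')) → Ready m e →
        Ready (UnchainedBandits.examine cmp c P (cmp m c q).2).2.2 e := fun e he hm =>
      i5 e (fun q' hq' => he q' (List.mem_cons_of_mem _ hq')) (s4 e (he q List.mem_cons_self) hm)
    have hdone : ∀ e, (∀ q' ∈ q :: P, e ≠ s(c, q')) → Done m e →
        Done (UnchainedBandits.examine cmp c P (cmp m c q).2).2.2 e := fun e he hm =>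
      i6 e (fun q' hq' => he q' (List.mem_cons_of_mem _ hq')) (s5 e (he q List.mem_cons_self) hm)
    rw [UnchainedBandits.examine, UnchainedBandits.examine, s1]
    simp only [i1]
    cases hv : (cmp m c q).1 with
    | first =>
      refine ⟨trivial, i2, hcost, i4.trans (List.sublist_cons_self q P), hready, hdone, i7, ?_, ?_⟩
      · intro q' hq' hn
        rcases List.mem_cons.mp hq' with rfl | hq'
        · exact s7 hv
        · exact i8 q' hq' hn
      · intro hf
        obtain ⟨q', hq', hd⟩ := i9 hf
        exact ⟨q', List.mem_cons_of_mem _ hq', hd⟩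
    | second =>
      refine ⟨trivial, i2, hcost, i4.cons_cons q, hready, hdone, nofun, ?_,
        fun _ => ⟨q, List.mem_cons_self, s8 hv⟩⟩
      intro q' hq' hn
      rw [List.mem_cons, not_or] at hn
      exact i8 q' ((List.mem_cons.mp hq').resolve_left hn.1) hn.2
    | incomparable =>
      refine ⟨trivial, i2, hcost, i4.cons_cons q, hready, hdone, ?_, ?_, ?_⟩
      · intro ht q' hq'
        rcases List.mem_cons.mp hq' with rfl | hq'
        · exact i6 _ (fun q'' hq'' => (hne q'' hq'').symm) (s6 hv)
        · exact i7 ht q' hq'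
      · intro q' hq' hn
        rw [List.mem_cons, not_or] at hn
        exact i8 q' ((List.mem_cons.mp hq').resolve_left hn.1) hn.2
      · intro hf
        obtain ⟨q', hq', hd⟩ := i9 hf
        exact ⟨q', List.mem_cons_of_mem _ hq', hd⟩

/-- The invariant is that current pivots are pairwise `Done`, which by `hw` bounds their number at
every examination, and that arms still to be examined are `Ready` with all others. A removed arm is
dominated by some arm of the list, which may itself be removed later. -/
theorem CompareSpec.routineLoop (h : CompareSpec T cmp cmp' Inv Ready Done dom cost M) {w : ℕ}
    (hw : ∀ m (P : List A), P.Nodup → (∀ a ∈ P, a ∈ T) →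
      (∀ a ∈ P, ∀ b ∈ P, a ≠ b → Done m s(a, b)) → P.length ≤ w) (cs : List A) :
    ∀ P m, (P ++ cs).Nodup → (∀ a ∈ P ++ cs, a ∈ T) → Inv m →
    (∀ a ∈ P, ∀ b ∈ P, a ≠ b → Done m s(a, b)) →
    (∀ a ∈ cs, ∀ b ∈ P ++ cs, a ≠ b → Ready m s(a, b)) →
    routineLoop cmp' cs P m = routineLoop cmp cs P m ∧
    Inv (routineLoop cmp cs P m).2 ∧
    cost (routineLoop cmp cs P m).2 ≤ cost m + M * w * cs.length ∧
    (∀ a ∈ (routineLoop cmp cs P m).1, a ∈ P ++ cs) ∧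
    (∀ a ∈ (routineLoop cmp cs P m).1, ∀ b ∈ (routineLoop cmp cs P m).1, a ≠ b →
      Done (routineLoop cmp cs P m).2 s(a, b)) ∧
    (∀ a ∈ P ++ cs, a ∉ (routineLoop cmp cs P m).1 → ∃ b ∈ P ++ cs, dom b a) := by
  induction cs with
  | nil =>
    intro P m _ _ hI hD _
    simp only [UnchainedBandits.routineLoop, List.append_nil, List.length_nil, mul_zero, add_zero]
    exact ⟨trivial, hI, le_rfl, fun a ha => ha, hD, fun a ha hn => absurd ha hn⟩
  | cons c cs ih =>
    intro P m hnd hT hI hD hR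
    obtain ⟨hndP, hndcs, hdisj⟩ := List.nodup_append.mp hnd
    obtain ⟨hccs, hndcs⟩ := List.nodup_cons.mp hndcs
    have hcP : c ∉ P := fun e => hdisj c e c List.mem_cons_self rfl
    have hmem : ∀ a ∈ P, a ∈ P ++ c :: cs := fun a ha => List.mem_append_left _ ha
    have hcmem : c ∈ P ++ c :: cs := List.mem_append_right _ List.mem_cons_self
    have hcs : ∀ a ∈ cs, a ∈ P ++ c :: cs := fun a ha =>
      List.mem_append_right _ (List.mem_cons_of_mem _ ha)
    obtain ⟨e1, e2, e3, e4, e5, e6, e7, e8, e9⟩ := h.examine (hT c hcmem) P m hndP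
      (fun q hq => hT q (hmem q hq)) hcP hI
      fun q hq => hR c List.mem_cons_self q (hmem q hq) fun e => hcP (e ▸ hq)
    set r := UnchainedBandits.examine cmp c P m with hr
    set P' : List A := if r.2.1 = true then r.1 ++ [c] else r.1 with hP'
    have hP'sub : ∀ a ∈ P', a ∈ P ∨ a = c := by
      intro a ha
      rw [hP'] at ha
      split_ifs at ha
      · rcases List.mem_append.mp ha with ha | ha
        · exact Or.inl (e4.subset ha)
        · exact Or.inr (List.mem_singleton.mp ha)
      · exact Or.inl (e4.subset ha)
    have hrP' : ∀ a ∈ r.1, a ∈ P' := by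
      intro a ha
      rw [hP']
      split_ifs
      · exact List.mem_append_left _ ha
      · exact ha
    have hnd' : (P' ++ cs).Nodup := by
      refine List.nodup_append.mpr ⟨?_, hndcs, ?_⟩
      · rw [hP']
        split_ifs
        · refine List.nodup_append.mpr ⟨e4.nodup hndP, List.nodup_singleton c, ?_⟩
          intro a ha b hb hab
          rw [List.mem_singleton.mp hb] at hab
          exact hcP (hab ▸ e4.subset ha)
        · exact e4.nodup hndP
      · intro a ha b hb hab
        rcases hP'sub a ha with ha | rfl
        · exact hdisj a ha b (List.mem_cons_of_mem _ hb) hab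
        · exact hccs (hab ▸ hb)
    have hsub : ∀ a ∈ P' ++ cs, a ∈ P ++ c :: cs := by
      intro a ha
      rcases List.mem_append.mp ha with ha | ha
      · rcases hP'sub a ha with ha | rfl
        · exact hmem a ha
        · exact hcmem
      · exact hcs a ha
    -- Pairs of old pivots do not involve `c`, so this examination leaves them untouched.
    have hDr : ∀ a ∈ r.1, ∀ b ∈ r.1, a ≠ b → Done r.2.2 s(a, b) := by
      intro a ha b hb hab
      refine e6 _ (fun q hq he => ?_) (hD a (e4.subset ha) b (e4.subset hb) hab)
      rcases Sym2.eq_iff.mp he with ⟨h1, _⟩ | ⟨_, h2⟩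
      · exact hcP (h1 ▸ e4.subset ha)
      · exact hcP (h2 ▸ e4.subset hb)
    have hD' : ∀ a ∈ P', ∀ b ∈ P', a ≠ b → Done r.2.2 s(a, b) := by
      intro a ha b hb hab
      rw [hP'] at ha hb
      split_ifs at ha hb with ht
      · rcases List.mem_append.mp ha with ha | ha <;> rcases List.mem_append.mp hb with hb | hb
        · exact hDr a ha b hb hab
        · rw [List.mem_singleton.mp hb, Sym2.eq_swap]
          exact e7 ht a ha
        · rw [List.mem_singleton.mp ha]
          exact e7 ht b hb
        · exact absurd ((List.mem_singleton.mp ha).trans (List.mem_singleton.mp hb).symm) hab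
      · exact hDr a ha b hb hab
    obtain ⟨i1, i2, i3, i4, i5, i6⟩ := ih P' r.2.2 hnd' (fun a ha => hT a (hsub a ha)) e2 hD' (by
      intro a ha b hb hab
      refine e5 _ (fun q hq he => ?_) (hR a (List.mem_cons_of_mem _ ha) b (hsub b hb) hab)
      rcases Sym2.eq_iff.mp he with ⟨h1, _⟩ | ⟨h1, _⟩
      · exact hccs (h1 ▸ ha)
      · exact hdisj q hq a (List.mem_cons_of_mem _ ha) h1.symm)
    have hlen := hw m P hndP (fun q hq => hT q (hmem q hq)) hD
    rw [UnchainedBandits.routineLoop, UnchainedBandits.routineLoop, e1]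
    simp only [← hr, ← hP']
    refine ⟨i1, i2, ?_, fun a ha => hsub a (i4 a ha), i5, ?_⟩
    · have := Nat.mul_le_mul_left M hlen
      rw [List.length_cons, Nat.mul_succ]
      omega
    · intro a ha hn
      by_cases ha' : a ∈ P' ++ cs
      · obtain ⟨b, hb, hd⟩ := i6 a ha' hn
        exact ⟨b, hsub b hb, hd⟩
      · rw [List.mem_append, not_or] at ha'
        rcases List.mem_append.mp ha with ha | ha
        · exact ⟨c, hcmem, e8 a ha fun har => ha'.1 (hrP' a har)⟩
        · rcases List.mem_cons.mp ha with rfl | ha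
          · have hf : r.2.1 = false := by
              by_contra ht
              rw [Bool.not_eq_false] at ht
              exact ha'.1 (by rw [hP', if_pos ht]; simp)
            obtain ⟨q, hq, hd⟩ := e9 hf
            exact ⟨q, hmem q hq, hd⟩
          · exact absurd ha ha'.2

theorem CompareSpec.ubsRoutine (h : CompareSpec T cmp cmp' Inv Ready Done dom cost M) {w : ℕ}
    (hw : ∀ m (P : List A), P.Nodup → (∀ a ∈ P, a ∈ T) →
      (∀ a ∈ P, ∀ b ∈ P, a ≠ b → Done m s(a, b)) → P.length ≤ w) {l : List A} (hl : l.Nodup)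
    (hlT : ∀ a, a ∈ l ↔ a ∈ T) {m : Memory A} (hI : Inv m)
    (hR : ∀ a ∈ T, ∀ b ∈ T, a ≠ b → Ready m s(a, b)) :
    ubsRoutine cmp' l m = ubsRoutine cmp l m ∧
    Inv (ubsRoutine cmp l m).2 ∧
    cost (ubsRoutine cmp l m).2 ≤ cost m + M * w * (T.card - 1) ∧
    (ubsRoutine cmp l m).1.toFinset ⊆ T ∧
    (∀ a ∈ (ubsRoutine cmp l m).1.toFinset, ∀ b ∈ (ubsRoutine cmp l m).1.toFinset, a ≠ b →
      Done (ubsRoutine cmp l m).2 s(a, b)) ∧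
    (∀ a ∈ T, a ∉ (ubsRoutine cmp l m).1.toFinset → ∃ b ∈ T, dom b a) := by
  have hcard : l.length = T.card := by
    rw [← List.toFinset_card_of_nodup hl]
    congr 1
    ext a
    rw [List.mem_toFinset, hlT]
  simp only [Finset.subset_iff, List.mem_toFinset]
  cases l with
  | nil =>
    simp only [UnchainedBandits.ubsRoutine]
    refine ⟨trivial, hI, Nat.le_add_right _ _, nofun, nofun, fun a ha => ?_⟩
    exact absurd ((hlT a).mpr ha) List.not_mem_nil
  | cons p cs =>
    obtain ⟨i1, i2, i3, i4, i5, i6⟩ := h.routineLoop hw cs [p] m hl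
      (fun a ha => (hlT a).mp ha) hI
      (fun a ha b hb hab => absurd
        ((List.mem_singleton.mp ha).trans (List.mem_singleton.mp hb).symm) hab)
      (fun a ha b hb hab => hR a ((hlT a).mp (List.mem_cons_of_mem _ ha)) b ((hlT b).mp hb) hab)
    -- The initial pivot is not examined. The `- 1` makes the cost vanish for a single arm.
    have hlen : cs.length = T.card - 1 := by
      rw [← hcard, List.length_cons, Nat.add_sub_cancel]
    rw [hlen] at i3
    refine ⟨i1, i2, i3, fun a ha => (hlT a).mp (i4 a ha), i5, fun a ha hn => ?_⟩
    obtain ⟨b, hb, hd⟩ := i6 a ((hlT a).mpr ha) hn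
    exact ⟨b, (hlT b).mp hb, hd⟩

end Routine


/-! ### The two comparison methods and the peeling phase. -/

section


variable {A : Type*}

/-- The pairs of distinct arms of `S`. -/
noncomputable def armPairs (S : Finset A) : Finset (Sym2 A) := S.offDiag.image fun p => s(p.1, p.2)

theorem mk_mem_armPairs {S : Finset A} {a b : A} (ha : a ∈ S) (hb : b ∈ S) (hab : a ≠ b) :
    s(a, b) ∈ armPairs S :=
  Finset.mem_image.mpr ⟨(a, b), Finset.mem_offDiag.mpr ⟨ha, hb, hab⟩, rfl⟩

theorem mem_of_mk_mem_armPairs {S : Finset A} {a b : A} (h : s(a, b) ∈ armPairs S) :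
    a ∈ S ∧ b ∈ S := by
  obtain ⟨⟨i, j⟩, hij, he⟩ := Finset.mem_image.mp h
  rw [Finset.mem_offDiag] at hij
  rcases Sym2.eq_iff.mp he with ⟨rfl, rfl⟩ | ⟨rfl, rfl⟩
  · exact ⟨hij.1, hij.2.1⟩
  · exact ⟨hij.2.1, hij.1⟩

/-- Only the pairs of arms of `S` have been compared, each with at most `b` duels. -/
def PullsBounded (S : Finset A) (b : ℝ) (m : Memory A) : Prop :=
  ∀ e, (m.pulls e : ℝ) ≤ b ∧ (e ∉ armPairs S → m.pulls e = 0)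

/-- The confidence interval of the pair `e` still contains `1 / 2`. -/
def Undecided (x : A → A → ℕ → Bool) (β ε : ℝ) (m : Memory A) (e : Sym2 A) : Prop :=
  m.pulls e ≤ horizon β ε ∧ ∀ a b, s(a, b) = e →
    |(wins x a b 0 (m.pulls e) : ℝ) - m.pulls e * (1 / 2)| < radius β ε

/-- A finer precision has a longer horizon and a larger radius, so an undecided pair enters the next
epoch undecided. -/
theorem Undecided.mono {x : A → A → ℕ → Bool} {β ε ε' : ℝ} {m : Memory A} {e : Sym2 A}
    (h : Undecided x β ε m e) (hβ : 0 < β) (hβ1 : β < 1) (hε : 0 < ε') (hle : ε' ≤ ε) :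
    Undecided x β ε' m e :=
  ⟨h.1.trans (horizon_mono hβ hβ1 hε hle), fun a b he =>
    (h.2 a b he).trans_le (radius_mono hβ hβ1 hε hle)⟩

theorem wins_congr {x y : A → A → ℕ → Bool} {i j : A} {n : ℕ} (h : ∀ k < n, y i j k = x i j k)
    {k : ℕ} (hk : k ≤ n) : wins y i j 0 k = wins x i j 0 k := by
  unfold wins
  congr 1
  refine Finset.filter_congr fun l hl => ?_
  rw [Finset.mem_range] at hl
  rw [h (0 + l) (by omega)]

variable [PartialOrder A]

/-- The confidence intervals for the duels of `i` and `j` are correct. -/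
def Concentrated (B : PosetBandit A) (x : A → A → ℕ → Bool) (β ε : ℝ) (i j : A) : Prop :=
  ∀ k ≤ horizon β ε, |(wins x i j 0 k : ℝ) - k * (1 / 2 + B.γ i j)| < radius β ε

/-- Since duels are reused, their number is controlled per pair by the invariant, and the cost per
comparison is set to `0`. Concentration is assumed only inside the domination relation: the other
clauses, in particular the dependence on finitely many duels, are needed for every table. -/
theorem directCompare_spec (B : PosetBandit A) {S T : Finset A} (hTS : T ⊆ S)
    {x y : A → A → ℕ → Bool} (hx : ∀ i j n, i ≠ j → x j i n = !(x i j n)) {β₁ ε b : ℝ}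
    (hβ : 0 < β₁) (hβ1 : β₁ < 1) (hε : 0 < ε)
    (hxy : ∀ i ∈ S, ∀ j ∈ S, i ≠ j → ∀ n < horizon β₁ ε, y i j n = x i j n)
    (hb : 3 * Real.log (2 / β₁) / ε ^ 2 ≤ b) (β : ℝ) :
    CompareSpec T (directCompare x ε β) (directCompare y ε β) (PullsBounded S b)
      (fun m e => (m.level e).getD β = β₁ ∧ Undecided x β₁ ε m e)
      (fun m e => m.level e = some β₁ ∧ Undecided x β₁ ε m e)
      (fun a b => (∀ i ∈ S, ∀ j ∈ S, i ≠ j → Concentrated B x β₁ ε i j) → b < a)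
      (fun _ => 0) 0 := by
  refine ⟨fun m i j hi hj hij hI hR => ?_⟩
  have hi := hTS hi
  have hj := hTS hj
  obtain ⟨hlev, hk, hin⟩ := hR
  obtain ⟨l1, l2, l3, l4, l5, l6⟩ := directLoop_spec hβ hβ1 hε (W := wins x i j 0)
    (W' := wins y i j 0) (fun k hk => wins_congr (hxy i hi j hj hij) hk) (horizon β₁ ε)
    (m.pulls s(i, j)) hk (Nat.le_add_left _ _) (hin i j rfl)
  simp only [directCompare, hlev, l1]
  set r := directLoop β₁ ε (wins x i j 0) (horizon β₁ ε) (m.pulls s(i, j)) with hr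
  refine ⟨trivial, ?_, le_rfl, ?_, ?_, ?_, ?_, ?_⟩
  · intro e
    by_cases he : e = s(i, j)
    · subst he
      simp only [Function.update_self]
      exact ⟨l3 b hb (hI _).1, fun h => absurd (mk_mem_armPairs hi hj hij) h⟩
    · simp only [Function.update_of_ne he]
      exact hI e
  · intro e he h
    simpa only [Undecided, Function.update_of_ne he] using h
  · intro e he h
    simpa only [Undecided, Function.update_of_ne he] using h
  · intro hv
    refine ⟨by simp only [Function.update_self], ?_⟩
    simp only [Undecided, Function.update_self]
    refine ⟨l2, fun a c hac => ?_⟩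
    rcases Sym2.eq_iff.mp hac with ⟨rfl, rfl⟩ | ⟨rfl, rfl⟩
    · exact l4 hv
    · rw [wins_swap fun n => hx c a n hij]
      rw [← abs_neg]
      convert l4 hv using 2
      ring
  · intro hv hC
    rw [B.order_compat]
    have h1 := (abs_lt.mp (hC i hi j hj hij _ l2)).2
    refine pos_of_mul_pos_right (a := (r.2 : ℝ)) ?_ (Nat.cast_nonneg _)
    linarith [l5 hv]
  · intro hv hC
    rw [B.order_compat, B.γ_swap i j]
    have h1 := (abs_lt.mp (hC i hi j hj hij _ l2)).1
    refine pos_of_mul_pos_right (a := (r.2 : ℝ)) ?_ (Nat.cast_nonneg _)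
    linarith [l6 hv]

/-- Distinct arms have distinct decoys: a common decoy lies below both arms, which forces each to
dominate the other. Hence different comparisons use different pairs of duellists, and each starts at
duel number `0`. -/
theorem mk_decoy_eq_mk_decoy {B : PosetBandit A} {S : Finset A} {Δ : ℝ} {d : A → A}
    (hd : CreatesDecoys B S Δ d) {a b i j : A} (ha : a ∈ S) (hb : b ∈ S) (hj : j ∈ S)
    (h : s(a, d b) = s(i, d j)) : a = i ∧ b = j := by
  rcases Sym2.eq_iff.mp h with ⟨h1, h2⟩ | ⟨h1, h2⟩
  · refine ⟨h1, le_antisymm ?_ ?_⟩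
    · exact hd.le_of_decoy_le b hb j hj (h2 ▸ (hd.isDecoy j hj).le)
    · exact hd.le_of_decoy_le j hj b hb (h2 ▸ (hd.isDecoy b hb).le)
  · exact absurd (h1 ▸ ha) (hd.isNew j hj)

/-- A positive gap against the decoy of `b` forces domination of `b`, and domination forces a gap of
at least `Δ`. Separating gaps `≥ Δ` from gaps `≤ 0` therefore decides comparability exactly. -/
theorem decoyCompare_spec [Fintype A] {B : PosetBandit A} {S T : Finset A} (hTS : T ⊆ S) {Δ : ℝ}
    {d : A → A} (hd : CreatesDecoys B S Δ d) {x : A → A → ℕ → Bool} {β : ℝ} (hβ : 0 < β)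
    (hβ1 : β < 1) (hΔ : 0 < Δ) (hΔ2 : Δ ≤ 1 / 2)
    (hC : ∀ a ∈ T, ∀ b ∈ T, a ≠ b → Concentrated B x (β / 2) Δ a (d b)) :
    CompareSpec T (decoyCompare x d Δ β) (decoyCompare x d Δ β) (fun _ => True)
      (fun m e => ∀ a ∈ S, ∀ b ∈ S, s(a, b) = e → m.pulls s(a, d b) = 0)
      (fun _ e => ∀ a b, s(a, b) = e → IncompRel (· ≤ ·) a b)
      (fun a b => b < a) totalPulls (2 * horizon (β / 2) Δ) := by
  refine ⟨fun m i j hiT hjT hij _ hR => ?_⟩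
  have hi := hTS hiT
  have hj := hTS hjT
  have hr := radius_pos (β := β / 2) (by linarith) (by linarith) hΔ
  obtain ⟨l1, l2, l3, l4⟩ := decoyLoop_spec (β := β / 2) (by linarith) (by linarith) hΔ hΔ2
    (hC i hiT j hjT hij) (hC j hjT i hiT hij.symm) (horizon (β / 2) Δ) 0 (Nat.zero_add _)
    (by simpa [wins] using hr) (by simpa [wins] using hr)
  simp only [decoyCompare, hR i hi j hj rfl, hR j hj i hi Sym2.eq_swap]
  set r := decoyLoop (β / 2) Δ (wins x i (d j) 0) (wins x j (d i) 0) (horizon (β / 2) Δ) 0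
  have key : ∀ a ∈ S, ∀ b ∈ S, 0 < B.γ a (d b) → a ≠ b → b < a := fun a ha b hb h hab =>
    lt_of_le_of_ne (hd.le_of_decoy_le b hb a ha ((B.order_compat _ _).mpr h).le) hab.symm
  refine ⟨trivial, trivial, ?_, ?_, fun _ _ h => h, ?_,
    fun hv => key i hi j hj (l3 hv) hij, fun hv => key j hj i hi (l4 hv) hij.symm⟩
  · simp only [totalPulls, Finset.sum_add_distrib, Finset.sum_ite_eq', Finset.mem_univ, if_true]
    omega
  · intro e he h a ha b hb hab
    have h1 : s(a, d b) ≠ s(i, d j) := by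
      intro h1
      obtain ⟨rfl, rfl⟩ := mk_decoy_eq_mk_decoy hd ha hb hj h1
      exact he hab.symm
    have h2 : s(a, d b) ≠ s(j, d i) := by
      intro h2
      obtain ⟨rfl, rfl⟩ := mk_decoy_eq_mk_decoy hd ha hb hi h2
      exact he (hab.symm.trans Sym2.eq_swap)
    simp only [if_neg h1, if_neg h2, add_zero]
    exact h a ha b hb hab
  · intro hv
    obtain ⟨h1, h2⟩ := l2 hv
    have hinc : IncompRel (· ≤ ·) i j :=
      ⟨fun h => absurd ((hd.isDecoy i hi).gap_of_le j hj h) (not_le.mpr h2),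
        fun h => absurd ((hd.isDecoy j hj).gap_of_le i hi h) (not_le.mpr h1)⟩
    intro a b hab
    rcases Sym2.eq_iff.mp hab with ⟨rfl, rfl⟩ | ⟨rfl, rfl⟩
    · exact hinc
    · exact hinc.symm

theorem not_lt_of_mem_paretoFront {S : Finset A} {a b : A} (ha : a ∈ paretoFront S) (hb : b ∈ S) :
    ¬ a < b := by
  intro h
  rcases (Finset.mem_filter.mp ha).2 b hb with h' | h'
  · exact absurd h' h.not_ge
  · exact h'.1 h.le

theorem exists_mem_paretoFront_ge {S : Finset A} {a : A} (ha : a ∈ S) :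
    ∃ b ∈ paretoFront S, a ≤ b := by
  obtain ⟨b, hab, hb⟩ := S.exists_le_maximal ha
  refine ⟨b, Finset.mem_filter.mpr ⟨hb.prop, fun c hc => ?_⟩, hab⟩
  by_cases hcb : c ≤ b
  · exact Or.inl hcb
  · exact Or.inr ⟨fun hbc => hcb (hb.le_of_ge hc hbc), hcb⟩

theorem length_le_width {S : Finset A} {P : List A} (hnd : P.Nodup) (hPS : ∀ a ∈ P, a ∈ S)
    (h : ∀ a ∈ P, ∀ b ∈ P, a ≠ b → IncompRel (· ≤ ·) a b) : P.length ≤ width S := by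
  rw [← List.toFinset_card_of_nodup hnd]
  refine Finset.le_sup (f := Finset.card) (Finset.mem_filter.mpr ⟨Finset.mem_powerset.mpr ?_, ?_⟩)
  · intro a ha
    exact hPS a (List.mem_toFinset.mp ha)
  · intro a ha b hb hab
    exact (h a (by simpa using ha) b (by simpa using hb) hab).1

theorem width_pos {S : Finset A} (hS : S.Nonempty) : 0 < width S := by
  obtain ⟨a, ha⟩ := hS
  exact length_le_width (P := [a]) (List.nodup_singleton a) (by simpa using ha) (by
    intro b hb c hc hbc
    exact absurd ((List.mem_singleton.mp hb).trans (List.mem_singleton.mp hc).symm) hbc)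

/-- After each epoch the surviving pairs have all been compared, so they carry the level `β₁` of the
first epoch, whatever the current number of arms. -/
theorem peel_spec (B : PosetBandit A) {S : Finset A} {x y : A → A → ℕ → Bool}
    (hx : ∀ i j n, i ≠ j → x j i n = !(x i j n)) {order : ℕ → Finset A → List A}
    (horder : ∀ t S', (order t S').Nodup ∧ ∀ a, a ∈ order t S' ↔ a ∈ S') {δ b β₁ : ℝ} {N : ℕ}
    {ε : ℕ → ℝ} (hβ₁ : δ / N / (S.card : ℝ) ^ 2 = β₁) (hβ : 0 < β₁) (hβ1 : β₁ < 1)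
    (hanti : AntitoneOn ε (Set.Icc 1 (N - 1))) (hε : ∀ t ∈ Set.Icc 1 (N - 1), 0 < ε t)
    (hxy : ∀ t ∈ Set.Icc 1 (N - 1), ∀ i ∈ S, ∀ j ∈ S, i ≠ j →
      ∀ n < horizon β₁ (ε t), y i j n = x i j n)
    (hb0 : 0 ≤ b) (hb : ∀ t ∈ Set.Icc 1 (N - 1), 3 * Real.log (2 / β₁) / ε t ^ 2 ≤ b) (t : ℕ)
    (ht : t ≤ N - 1) :
    peel y order S δ N ε t = peel x order S δ N ε t ∧
    (peel x order S δ N ε t).1 ⊆ S ∧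
    PullsBounded S b (peel x order S δ N ε t).2 ∧
    (0 < t → ∀ i ∈ (peel x order S δ N ε t).1, ∀ j ∈ (peel x order S δ N ε t).1, i ≠ j →
      (peel x order S δ N ε t).2.level s(i, j) = some β₁ ∧
        Undecided x β₁ (ε t) (peel x order S δ N ε t).2 s(i, j)) ∧
    ((∀ t ∈ Set.Icc 1 (N - 1), ∀ i ∈ S, ∀ j ∈ S, i ≠ j → Concentrated B x β₁ (ε t) i j) →
      paretoFront S ⊆ (peel x order S δ N ε t).1) := by
  induction t with
  | zero =>
    refine ⟨rfl, subset_rfl, fun e => ⟨by simpa [peel, Memory.empty] using hb0, fun _ => rfl⟩,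
      fun h => absurd h (lt_irrefl 0), fun _ => Finset.filter_subset _ _⟩
  | succ t ih =>
    obtain ⟨i1, i2, i3, i4, i5⟩ := ih (by omega)
    have ht1 : t + 1 ∈ Set.Icc 1 (N - 1) := ⟨by omega, ht⟩
    set s := peel x order S δ N ε t with hs
    have spec := directCompare_spec B i2 hx hβ hβ1 (hε _ ht1) (hxy _ ht1) (hb _ ht1)
      (δ / N / (s.1.card : ℝ) ^ 2)
    have hR : ∀ i ∈ s.1, ∀ j ∈ s.1, i ≠ j →
        (s.2.level s(i, j)).getD (δ / N / (s.1.card : ℝ) ^ 2) = β₁ ∧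
          Undecided x β₁ (ε (t + 1)) s.2 s(i, j) := by
      intro i hi j hj hij
      -- In the first epoch no level is stored and the default value is `β₁`. Later the stored level
      -- overrides the default.
      rcases Nat.eq_zero_or_pos t with rfl | htpos
      · refine ⟨hβ₁, Nat.zero_le _, fun a c _ => ?_⟩
        have := radius_pos hβ hβ1 (hε _ ht1)
        simpa [hs, peel, Memory.empty, wins] using this
      · obtain ⟨h1, h2⟩ := i4 htpos i hi j hj hij
        exact ⟨by rw [h1, Option.getD_some], h2.mono hβ hβ1 (hε _ ht1)
          (hanti ⟨htpos, by omega⟩ ht1 (Nat.le_succ t))⟩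
    obtain ⟨o1, o2⟩ := horder (t + 1) s.1
    obtain ⟨r1, r2, -, r4, r5, r6⟩ := spec.ubsRoutine (w := s.1.card)
      (fun _ P hnd hP _ => by
        rw [← List.toFinset_card_of_nodup hnd]
        exact Finset.card_le_card fun a ha => hP a (List.mem_toFinset.mp ha)) o1 o2 i3 hR
    simp only [peel, i1, ← hs, r1]
    refine ⟨trivial, r4.trans i2, r2, fun _ => r5, fun hC a ha => ?_⟩
    by_contra hn
    obtain ⟨c, hc, hlt⟩ := r6 a (i5 hC ha) hn
    exact not_lt_of_mem_paretoFront ha (i2 hc) (hlt (hC _ ht1))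

end


/-! ### Duel counts, and success on correct intervals. -/

section


theorem totalPulls_le_of_pullsBounded {A : Type*} [Fintype A] {S : Finset A} {b : ℝ} {m : Memory A}
    (h : PullsBounded S b m) (hb : 0 ≤ b) :
    (totalPulls m : ℝ) ≤ (S.card : ℝ) * (S.card - 1) * b := by
  have h1 : totalPulls m = ∑ e ∈ armPairs S, m.pulls e :=
    (Finset.sum_subset (Finset.subset_univ _) fun e _ he => (h e).2 he).symm
  have h2 : ((armPairs S).card : ℝ) ≤ (S.card : ℝ) * (S.card - 1) := by
    have h3 : (armPairs S).card ≤ S.card * S.card - S.card := by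
      rw [← Finset.offDiag_card]
      exact Finset.card_image_le
    calc ((armPairs S).card : ℝ) ≤ ((S.card * S.card - S.card : ℕ) : ℝ) := by exact_mod_cast h3
      _ = (S.card : ℝ) * (S.card - 1) := by
        rw [Nat.cast_sub (Nat.le_mul_self _)]
        push_cast
        ring
  rw [h1, Nat.cast_sum]
  refine (Finset.sum_le_card_nsmul _ _ b fun e _ => (h e).1).trans ?_
  rw [nsmul_eq_mul]
  exact mul_le_mul_of_nonneg_right h2 hb

variable {A : Type*} [PartialOrder A]

/-- The lower bound on the precisions makes the cost per pair smaller by a factor `w / K`, which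
turns `K²` pairs into `K w`. -/
theorem div_pow_le_of_mul_sqrt_le {K w Δ ε L : ℝ} (hK : 0 < K) (hw : 0 < w) (hΔ : 0 < Δ)
    (hL : 0 ≤ L) (h : Δ * √(K / w) ≤ ε) : L / ε ^ 2 ≤ L * w / (K * Δ ^ 2) := by
  have h1 : Δ ^ 2 * (K / w) ≤ ε ^ 2 := by
    rw [← Real.sq_sqrt (show 0 ≤ K / w by positivity), ← mul_pow]
    exact pow_le_pow_left₀ (by positivity) h 2
  refine (div_le_div_of_nonneg_left hL (by positivity) h1).trans (le_of_eq ?_)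
  field_simp

/-- On correct confidence intervals, the algorithm succeeds. -/
theorem unchainedBandits_correct [Fintype A] {B : PosetBandit A} {S : Finset A} (hS : S.Nonempty)
    {δ Δ : ℝ} (hδ : 0 < δ) (hδ1 : δ < 1) (hΔ : 0 < Δ) {d : A → A} (hd : CreatesDecoys B S Δ d)
    {N : ℕ} (hN : 1 ≤ N) {ε : ℕ → ℝ} (hanti : AntitoneOn ε (Set.Icc 1 (N - 1)))
    (hε : ∀ t ∈ Set.Icc 1 (N - 1), Δ * √((S.card : ℝ) / (width S : ℝ)) ≤ ε t)
    {order : ℕ → Finset A → List A}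
    (horder : ∀ t S', (order t S').Nodup ∧ ∀ a, a ∈ order t S' ↔ a ∈ S')
    {x : A → A → ℕ → Bool} (hx : ∀ i j n, i ≠ j → x j i n = !(x i j n))
    (h1 : ∀ t ∈ Set.Icc 1 (N - 1), ∀ i ∈ S, ∀ j ∈ S, i ≠ j →
      Concentrated B x (δ / N / (S.card : ℝ) ^ 2) (ε t) i j)
    (h2 : ∀ i ∈ (peel x order S δ N ε (N - 1)).1, ∀ j ∈ (peel x order S δ N ε (N - 1)).1, i ≠ j →
      Concentrated B x (δ / N / ((peel x order S δ N ε (N - 1)).1.card : ℝ) ^ 2 / 2) Δ i (d j)) :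
    (unchainedBandits x order d S δ Δ N ε).1 = paretoFront S ∧
    (totalPulls (unchainedBandits x order d S δ Δ N ε).2 : ℝ) ≤
      18 * ((S.card : ℝ) * (width S : ℝ) * Real.log ((N : ℝ) * (S.card : ℝ) ^ 2 / δ) / Δ ^ 2) := by
  have hN1 : (1 : ℝ) ≤ N := by exact_mod_cast hN
  have hw : (1 : ℝ) ≤ width S := by exact_mod_cast width_pos hS
  have hK : (1 : ℝ) ≤ S.card := by exact_mod_cast hS.card_pos
  have hΔ2 : Δ ≤ 1 / 2 := by
    obtain ⟨a, ha⟩ := hS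
    exact (hd.isDecoy a ha).gap.trans (B.γ_mem a (d a)).2.le
  have hlevel : ∀ k : ℝ, 1 ≤ k → 0 < δ / N / k ^ 2 ∧ δ / N / k ^ 2 < 1 := by
    intro k hk
    refine ⟨by positivity, ?_⟩
    rw [div_div, div_lt_one (by positivity)]
    nlinarith [one_le_mul_of_one_le_of_one_le hN1 (one_le_pow₀ hk (n := 2))]
  obtain ⟨hβ, hβ1⟩ := hlevel _ hK
  set β₁ := δ / N / (S.card : ℝ) ^ 2 with hβ₁
  set L := Real.log (2 / β₁) with hL
  have hL0 : 0 ≤ L := (Real.log_pos one_lt_two).le.trans (log_two_le_log_div hβ hβ1)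
  set b := 3 * L * width S / (S.card * Δ ^ 2) with hb
  have hb0 : 0 ≤ b := by positivity
  obtain ⟨-, p2, p3, -, p5⟩ := peel_spec B (y := x) hx horder hβ₁.symm hβ hβ1 hanti
    (fun t ht => lt_of_lt_of_le (by positivity) (hε t ht)) (fun _ _ _ _ _ _ _ _ _ => rfl) hb0
    (fun t ht => div_pow_le_of_mul_sqrt_le (by linarith) (by linarith) hΔ (by positivity)
      (hε t ht)) (N - 1) le_rfl
  replace p5 := p5 h1
  set s := peel x order S δ N ε (N - 1) with hs
  have hsK : (s.1.card : ℝ) ≤ S.card := by exact_mod_cast Finset.card_le_card p2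
  have hs1 : (1 : ℝ) ≤ s.1.card := by
    obtain ⟨a, ha⟩ := hS
    obtain ⟨c, hc, -⟩ := exists_mem_paretoFront_ge ha
    exact_mod_cast Finset.card_pos.mpr ⟨c, p5 hc⟩
  obtain ⟨hβ', hβ1'⟩ := hlevel _ hs1
  set β := δ / N / (s.1.card : ℝ) ^ 2 with hβdef
  obtain ⟨o1, o2⟩ := horder N s.1
  -- Peeling only plays duels inside `S`, so no duel against a decoy has been played yet.
  obtain ⟨-, -, r3, r4, r5, r6⟩ :=
    (decoyCompare_spec p2 hd hβ' hβ1' hΔ hΔ2 h2).ubsRoutine (w := width S)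
      (fun _ P hnd hP hinc => length_le_width hnd (fun a ha => p2 (hP a ha))
        fun a ha c hc hac => hinc a ha c hc hac a c rfl) o1 o2 trivial
      (m := s.2) (fun a _ c _ _ i hi j hj _ =>
        (p3 s(i, d j)).2 fun h => hd.isNew j hj (mem_of_mk_mem_armPairs h).2)
  simp only [unchainedBandits, ← hs, ← hβdef]
  set r := ubsRoutine (decoyCompare x d Δ β) (order N s.1) s.2
  have hsubset : paretoFront S ⊆ r.1.toFinset := by
    intro a ha
    by_contra hn
    obtain ⟨c, hc, hlt⟩ := r6 a (p5 ha) hn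
    exact not_lt_of_mem_paretoFront ha (p2 hc) hlt
  refine ⟨Finset.Subset.antisymm (fun a ha => ?_) hsubset, ?_⟩
  · obtain ⟨c, hc, hac⟩ := exists_mem_paretoFront_ge (p2 (r4 ha))
    by_cases he : a = c
    · exact he ▸ hc
    · exact absurd hac (r5 a ha c (hsubset hc) he a c rfl).1
  · have q1 := totalPulls_le_of_pullsBounded p3 hb0
    have q2 : (horizon (β / 2) Δ : ℝ) ≤ 3 * Real.log (2 / (β / 2)) / Δ ^ 2 :=
      horizon_le (by linarith) (by linarith) hΔ hΔ2
    set X : ℝ := (N : ℝ) * (S.card : ℝ) ^ 2 / δ with hX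
    have q3 : (totalPulls r.2 : ℝ) ≤ totalPulls s.2 +
        2 * horizon (β / 2) Δ * width S * (s.1.card - 1) := by
      have h3 : ((s.1.card - 1 : ℕ) : ℝ) = s.1.card - 1 := by
        rw [Nat.cast_sub (by exact_mod_cast hs1), Nat.cast_one]
      rw [← h3]
      exact_mod_cast r3
    -- For `K = 1` the logarithm may be arbitrarily close to `0`, but no duel is played. For `K ≥ 2`
    -- one has `X ≥ 4`, so `4 X ≤ X²` and constants inside the logarithm cost a factor `2`.
    rcases eq_or_lt_of_le (show 1 ≤ S.card from hS.card_pos) with hK1 | hK2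
    · have hK1' : (S.card : ℝ) = 1 := by exact_mod_cast hK1.symm
      have hs1' : (s.1.card : ℝ) = 1 := le_antisymm (hsK.trans_eq hK1') hs1
      rw [hK1', sub_self, mul_zero, zero_mul] at q1
      rw [hs1', sub_self, mul_zero] at q3
      have hX1 : 1 ≤ X := by
        rw [hX, hK1', le_div_iff₀ hδ]
        linarith
      have := Real.log_nonneg hX1
      refine (show (totalPulls r.2 : ℝ) ≤ 0 by linarith).trans (by positivity)
    · have hK2' : (2 : ℝ) ≤ S.card := by exact_mod_cast hK2
      have hX4 : 4 ≤ X := by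
        rw [hX, le_div_iff₀ hδ]
        nlinarith [mul_le_mul hN1 (pow_le_pow_left₀ zero_le_two hK2' 2) (by norm_num) (by linarith)]
      have hX0 : 0 < X := by linarith
      have hlog : ∀ z : ℝ, 0 < z → z ≤ 4 * X → Real.log z ≤ 2 * Real.log X := by
        intro z hz hzX
        rw [← Nat.cast_two, ← Real.log_pow]
        exact Real.log_le_log hz (by nlinarith)
      have hl1 : L ≤ 2 * Real.log X := by
        refine hlog _ (by positivity) ?_
        have : 2 / β₁ = 2 * X := by
          rw [hβ₁, hX]
          field_simp
        linarith
      have hl2 : Real.log (2 / (β / 2)) ≤ 2 * Real.log X := by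
        refine hlog _ (by positivity) ?_
        have h4 : 2 / (β / 2) = 4 * (N * (s.1.card : ℝ) ^ 2 / δ) := by
          rw [hβdef]
          field_simp
          norm_num
        rw [h4, hX]
        gcongr
      have hX' : 0 ≤ Real.log X := Real.log_nonneg (by linarith)
      have e1 : (S.card : ℝ) * (S.card - 1) * b ≤
          6 * (S.card * width S * Real.log X / Δ ^ 2) := by
        calc (S.card : ℝ) * (S.card - 1) * b ≤ S.card * S.card * b := by
              gcongr
              linarith
          _ = 3 * (S.card * width S * L / Δ ^ 2) := by
              rw [hb]
              field_simp
          _ ≤ 3 * (S.card * width S * (2 * Real.log X) / Δ ^ 2) := by gcongr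
          _ = 6 * (S.card * width S * Real.log X / Δ ^ 2) := by ring
      -- The constant `12` is two duels per round, times `3` from `horizon_le`, times `2` from the
      -- logarithm. With `6 = 3 * 2` from peeling this gives `18`.
      have e2 : 2 * horizon (β / 2) Δ * width S * ((s.1.card : ℝ) - 1) ≤
          12 * (S.card * width S * Real.log X / Δ ^ 2) := by
        calc 2 * horizon (β / 2) Δ * width S * ((s.1.card : ℝ) - 1)
            ≤ 2 * (3 * (2 * Real.log X) / Δ ^ 2) * width S * S.card := by
              refine mul_le_mul ?_ (by linarith) (by linarith) (by positivity)
              refine mul_le_mul_of_nonneg_right ?_ (by positivity)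
              refine mul_le_mul_of_nonneg_left (q2.trans ?_) zero_le_two
              gcongr
          _ = 12 * (S.card * width S * Real.log X / Δ ^ 2) := by ring
      linarith

/-! ### Failure probabilities of the direct and decoy comparisons. -/

section Probability

variable {B : PosetBandit A} {Ω : Type*} [MeasurableSpace Ω] {μ : Measure Ω}
  {X : A → A → ℕ → Ω → Bool}

theorem IsDuelTable.eq_of_out_eq (h : IsDuelTable B μ X) {i j : A} (hij : i ≠ j) {n : ℕ} {ω ω' : Ω}
    (he : X (Quot.out s(i, j)).1 (Quot.out s(i, j)).2 n ω =
      X (Quot.out s(i, j)).1 (Quot.out s(i, j)).2 n ω') : X i j n ω = X i j n ω' := by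
  rcases h.eq_or_eq_not hij n ω with ⟨h1, h1'⟩ | ⟨h1, h1'⟩ <;>
    rcases h.eq_or_eq_not hij n ω' with ⟨h2, h2'⟩ | ⟨h2, h2'⟩
  · rw [← h1, ← h2, he]
  · exact absurd (Prod.ext_iff.mp (h1'.symm.trans h2')).1 hij
  · exact absurd (Prod.ext_iff.mp (h1'.symm.trans h2')).2 hij
  · rw [h1, h2] at he
    simpa using he

theorem Concentrated.congr {x y : A → A → ℕ → Bool} {β ε : ℝ} {i j : A}
    (h : Concentrated B x β ε i j) (hxy : ∀ n < horizon β ε, y i j n = x i j n) :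
    Concentrated B y β ε i j := by
  intro k hk
  rw [wins_congr hxy hk]
  exact h k hk

variable [IsProbabilityMeasure μ]

theorem IsDuelTable.measureReal_not_concentrated_le (h : IsDuelTable B μ X) {ι : Type*} {f g : ι → A}
    {s : Finset ι} (hf : ∀ p ∈ s, f p ≠ g p) {β ε : ℝ}
    (hβ : s.Nonempty → 0 < β ∧ β < 1) (hε : s.Nonempty → 0 < ε) :
    μ.real {ω | ∃ p ∈ s, ¬ Concentrated B (fun i j n => X i j n ω) β ε (f p) (g p)} ≤
      s.card * β := by
  have hset : {ω | ∃ p ∈ s, ¬ Concentrated B (fun i j n => X i j n ω) β ε (f p) (g p)} =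
      ⋃ p ∈ s, {ω | ¬ Concentrated B (fun i j n => X i j n ω) β ε (f p) (g p)} := by
    ext ω
    simp
  rw [hset, ← nsmul_eq_mul]
  refine (measureReal_biUnion_finset_le s _).trans (Finset.sum_le_card_nsmul _ _ _ fun p hp => ?_)
  exact h.measureReal_not_mem_confInterval_le (hf p hp) (hβ ⟨p, hp⟩).1 (hβ ⟨p, hp⟩).2 (hε ⟨p, hp⟩)

/-- The arms compared with decoys only depend on the duels between arms of `S`: given these arms,
the failure probability of the comparisons with decoys is that of new duels. -/
theorem IsDuelTable.measureReal_decoy_failure_le (h : IsDuelTable B μ X) {S : Finset A} {δ Δ : ℝ}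
    (hδ : 0 < δ) (hδ1 : δ < 1) (hΔ : 0 < Δ) {d : A → A} (hd : CreatesDecoys B S Δ d) {N : ℕ}
    (hN : 1 ≤ N) {R : Ω → Finset A} (hRS : ∀ ω, R ω ⊆ S) {H : ℕ}
    (hR : ∀ ω ω', (∀ i ∈ S, ∀ j ∈ S, i ≠ j → ∀ n < H, X i j n ω = X i j n ω') → R ω = R ω') :
    μ.real {ω | ∃ p ∈ (R ω).offDiag, ¬ Concentrated B (fun i j n => X i j n ω)
      (δ / N / ((R ω).card : ℝ) ^ 2 / 2) Δ p.1 (d p.2)} ≤ δ / N := by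
  have hN1 : (1 : ℝ) ≤ N := by exact_mod_cast hN
  set V : Finset A → Set Ω := fun T => {ω | ∃ p ∈ T.offDiag,
    ¬ Concentrated B (fun i j n => X i j n ω) (δ / N / (T.card : ℝ) ^ 2 / 2) Δ p.1 (d p.2)} with hV
  have hne : ∀ T ⊆ S, ∀ p ∈ T.offDiag, p.1 ≠ d p.2 := fun T hT p hp he => by
    rw [Finset.mem_offDiag] at hp
    exact hd.isNew p.2 (hT hp.2.1) (he ▸ hT hp.1)
  have hVle : ∀ T ⊆ S, μ.real (V T) ≤ δ / N := by
    intro T hT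
    have hpos : T.offDiag.Nonempty → (1 : ℝ) ≤ T.card := by
      rintro ⟨p, hp⟩
      exact_mod_cast Finset.card_pos.mpr ⟨p.1, (Finset.mem_offDiag.mp hp).1⟩
    refine (h.measureReal_not_concentrated_le (f := Prod.fst) (g := fun p => d p.2)
      (s := T.offDiag) (β := δ / N / (T.card : ℝ) ^ 2 / 2) (ε := Δ)
      (hne T hT) (fun hT0 => ?_) fun _ => hΔ).trans ?_
    · have hT1 := hpos hT0
      refine ⟨by positivity, ?_⟩
      have : δ / N / (T.card : ℝ) ^ 2 < 1 := by
        rw [div_div, div_lt_one (by positivity)]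
        nlinarith [one_le_mul_of_one_le_of_one_le hN1 (one_le_pow₀ hT1 (n := 2))]
      linarith
    · rcases T.offDiag.eq_empty_or_nonempty with h0 | h0
      · rw [h0, Finset.card_empty, Nat.cast_zero, zero_mul]
        positivity
      · have hT1 := hpos h0
        have hcard : (T.offDiag.card : ℝ) ≤ (T.card : ℝ) ^ 2 := by
          rw [Finset.offDiag_card, sq]
          exact_mod_cast Nat.sub_le _ _
        calc (T.offDiag.card : ℝ) * (δ / N / (T.card : ℝ) ^ 2 / 2)
            ≤ (T.card : ℝ) ^ 2 * (δ / N / (T.card : ℝ) ^ 2 / 2) := by gcongr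
          _ = δ / N / 2 := by field_simp
          _ ≤ δ / N := half_le_self (by positivity)
  -- The event `R = T` depends on pairs inside `S`, and `V T` on pairs that contain a decoy, which
  -- is outside `S`.
  have hind : ∀ T ⊆ S, MeasurableSet {ω | R ω = T} ∧
      μ ({ω | R ω = T} ∩ V T) = μ {ω | R ω = T} * μ (V T) := by
    intro T hT
    refine h.measure_inter (F := armPairs S ×ˢ Finset.range H)
      (G := T.offDiag.image (fun p => s(p.1, d p.2)) ×ˢ
        Finset.range (horizon (δ / N / (T.card : ℝ) ^ 2 / 2) Δ)) ?_ ?_ ?_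
    · refine Finset.disjoint_left.mpr fun q hq hq' => ?_
      obtain ⟨p, hp, hpq⟩ := Finset.mem_image.mp (Finset.mem_product.mp hq').1
      rw [Finset.mem_offDiag] at hp
      have hmem := (Finset.mem_product.mp hq).1
      rw [← hpq] at hmem
      exact hd.isNew p.2 (hT hp.2.1) (mem_of_mk_mem_armPairs hmem).2
    · intro ω ω' hq hω
      refine (hR ω' ω fun i hi j hj hij n hn => ?_).trans hω
      exact (h.eq_of_out_eq hij (hq (s(i, j), n) (Finset.mem_product.mpr
        ⟨mk_mem_armPairs hi hj hij, Finset.mem_range.mpr hn⟩))).symm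
    · rintro ω ω' hq ⟨p, hp, hc⟩
      refine ⟨p, hp, fun hc' => hc (hc'.congr fun n hn => ?_)⟩
      exact h.eq_of_out_eq (hne T hT p hp) (hq (s(p.1, d p.2), n) (Finset.mem_product.mpr
        ⟨Finset.mem_image_of_mem (fun p => s(p.1, d p.2)) hp, Finset.mem_range.mpr hn⟩))
  have hsub : {ω | ∃ p ∈ (R ω).offDiag, ¬ Concentrated B (fun i j n => X i j n ω)
      (δ / N / ((R ω).card : ℝ) ^ 2 / 2) Δ p.1 (d p.2)} ⊆
      ⋃ T ∈ S.powerset, ({ω | R ω = T} ∩ V T) := by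
    intro ω hω
    simp only [Set.mem_iUnion]
    exact ⟨R ω, Finset.mem_powerset.mpr (hRS ω), rfl, hω⟩
  -- The events `R = T` are measurable and disjoint, so the conditional bounds `δ / N` average to `δ
  -- / N`.
  have hsum : ∑ T ∈ S.powerset, μ.real {ω | R ω = T} ≤ 1 := by
    rw [← measureReal_biUnion_finset (fun T _ T' _ hTT' => ?_) fun T hT =>
      (hind T (Finset.mem_powerset.mp hT)).1]
    · exact measureReal_le_one
    · refine Set.disjoint_left.mpr fun ω hω hω' => hTT' ?_
      exact (show R ω = T from hω).symm.trans hω'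
  calc _ ≤ μ.real (⋃ T ∈ S.powerset, ({ω | R ω = T} ∩ V T)) :=
        measureReal_mono hsub (measure_ne_top μ _)
    _ ≤ ∑ T ∈ S.powerset, μ.real ({ω | R ω = T} ∩ V T) := measureReal_biUnion_finset_le _ _
    _ ≤ ∑ T ∈ S.powerset, μ.real {ω | R ω = T} * (δ / N) := by
      refine Finset.sum_le_sum fun T hT => ?_
      have hT := Finset.mem_powerset.mp hT
      rw [measureReal_def, (hind T hT).2, ENNReal.toReal_mul]
      exact mul_le_mul_of_nonneg_left (hVle T hT) measureReal_nonneg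
    _ = (∑ T ∈ S.powerset, μ.real {ω | R ω = T}) * (δ / N) := by rw [Finset.sum_mul]
    _ ≤ 1 * (δ / N) := mul_le_mul_of_nonneg_right hsum (by positivity)
    _ = δ / N := one_mul _

/-- The failure probability of the direct comparisons. -/
theorem IsDuelTable.measureReal_direct_failure_le (h : IsDuelTable B μ X) {S : Finset A}
    (hS : S.Nonempty) {δ : ℝ} (hδ : 0 < δ) (hδ1 : δ < 1) {N : ℕ} (hN : 1 ≤ N) {ε : ℕ → ℝ}
    (hε : ∀ t ∈ Set.Icc 1 (N - 1), 0 < ε t) :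
    μ.real {ω | ∃ t ∈ Finset.Icc 1 (N - 1), ∃ p ∈ S.offDiag, ¬ Concentrated B
      (fun i j n => X i j n ω) (δ / N / (S.card : ℝ) ^ 2) (ε t) p.1 p.2} ≤ (N - 1) * (δ / N) := by
  have hN1 : (1 : ℝ) ≤ N := by exact_mod_cast hN
  have hK : (1 : ℝ) ≤ S.card := by exact_mod_cast hS.card_pos
  have hβ1 : δ / N / (S.card : ℝ) ^ 2 < 1 := by
    rw [div_div, div_lt_one (by positivity)]
    nlinarith [one_le_mul_of_one_le_of_one_le hN1 (one_le_pow₀ hK (n := 2))]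
  have hset : {ω | ∃ t ∈ Finset.Icc 1 (N - 1), ∃ p ∈ S.offDiag, ¬ Concentrated B
      (fun i j n => X i j n ω) (δ / N / (S.card : ℝ) ^ 2) (ε t) p.1 p.2} =
      ⋃ t ∈ Finset.Icc 1 (N - 1), {ω | ∃ p ∈ S.offDiag, ¬ Concentrated B
        (fun i j n => X i j n ω) (δ / N / (S.card : ℝ) ^ 2) (ε t) p.1 p.2} := by
    ext ω
    simp
  rw [hset]
  refine (measureReal_biUnion_finset_le _ _).trans
    ((Finset.sum_le_card_nsmul _ _ (δ / N) fun t ht => ?_).trans (le_of_eq ?_))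
  · refine (h.measureReal_not_concentrated_le (f := Prod.fst) (g := Prod.snd) (s := S.offDiag)
      (fun p hp => (Finset.mem_offDiag.mp hp).2.2) (fun _ => ⟨by positivity, hβ1⟩)
      fun _ => hε t (Finset.mem_Icc.mp ht)).trans ?_
    have hcard : (S.offDiag.card : ℝ) ≤ (S.card : ℝ) ^ 2 := by
      rw [Finset.offDiag_card, sq]
      exact_mod_cast Nat.sub_le _ _
    calc (S.offDiag.card : ℝ) * (δ / N / (S.card : ℝ) ^ 2)
        ≤ (S.card : ℝ) ^ 2 * (δ / N / (S.card : ℝ) ^ 2) := by gcongr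
      _ = δ / N := by field_simp
  · rw [Nat.card_Icc, nsmul_eq_mul, Nat.add_sub_cancel, Nat.cast_sub hN, Nat.cast_one]

end Probability

end

end UnchainedBandits

end

/-! ### Union bound over all epochs. -/

theorem mainTheorem1 :
    ∃ C : ℝ, 0 < C ∧
      ∀ (A : Type*) [Fintype A] [PartialOrder A] (B : UnchainedBandits.PosetBandit A)
        (S : Finset A) (_ : S.Nonempty)
        (δ Δ : ℝ) (_ : 0 < δ) (_ : δ < 1) (_ : 0 < Δ)
        (d : A → A) (_ : UnchainedBandits.CreatesDecoys B S Δ d)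
        (N : ℕ) (_ : 1 ≤ N)
        (ε : ℕ → ℝ) (_ : AntitoneOn ε (Set.Icc 1 (N - 1)))
        (_ : ∀ t ∈ Set.Icc 1 (N - 1),
          Δ * √((S.card : ℝ) / (UnchainedBandits.width S : ℝ)) ≤ ε t)
        (order : ℕ → Finset A → List A)
        (_ : ∀ t S', (order t S').Nodup ∧ ∀ a, a ∈ order t S' ↔ a ∈ S')
        (Ω : Type*) [MeasurableSpace Ω] (μ : MeasureTheory.Measure Ω)
        [MeasureTheory.IsProbabilityMeasure μ]
        (X : A → A → ℕ → Ω → Bool) (_ : UnchainedBandits.IsDuelTable B μ X),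
        1 - δ ≤ μ.real {ω |
          (UnchainedBandits.unchainedBandits (fun i j n => X i j n ω) order d S δ Δ N ε).1 =
              UnchainedBandits.paretoFront S ∧
          (UnchainedBandits.totalPulls (UnchainedBandits.unchainedBandits
              (fun i j n => X i j n ω) order d S δ Δ N ε).2 : ℝ) ≤
            C * ((S.card : ℝ) * (UnchainedBandits.width S : ℝ) *
              Real.log ((N : ℝ) * (S.card : ℝ) ^ 2 / δ) / Δ ^ 2)} := by
  refine ⟨18, by norm_num, ?_⟩
  intro A _ _ B S hS δ Δ hδ hδ1 hΔ d hd N hN ε hanti hε order horder Ω _ μ _ X hX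
  have hN1 : (1 : ℝ) ≤ N := by exact_mod_cast hN
  have hw : (1 : ℝ) ≤ UnchainedBandits.width S := by
    exact_mod_cast UnchainedBandits.width_pos hS
  have hK : (1 : ℝ) ≤ S.card := by exact_mod_cast hS.card_pos
  have hε0 : ∀ t ∈ Set.Icc 1 (N - 1), 0 < ε t := fun t ht =>
    lt_of_lt_of_le (by positivity) (hε t ht)
  have hβ0 : 0 < δ / N / (S.card : ℝ) ^ 2 := by positivity
  have hβ1 : δ / N / (S.card : ℝ) ^ 2 < 1 := by
    rw [div_div, div_lt_one (by positivity)]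
    nlinarith [one_le_mul_of_one_le_of_one_le hN1 (one_le_pow₀ hK (n := 2))]
  have hswap : ∀ ω i j n, i ≠ j → X j i n ω = !(X i j n ω) := fun ω i j n =>
    hX.swap i j n ω
  have hL : 0 ≤ Real.log (2 / (δ / N / (S.card : ℝ) ^ 2)) :=
    (Real.log_pos one_lt_two).le.trans (UnchainedBandits.log_two_le_log_div hβ0 hβ1)
  set R : Ω → Finset A := fun ω =>
    (UnchainedBandits.peel (fun i j n => X i j n ω) order S δ N ε (N - 1)).1 with hR
  -- The largest horizon of the peeling epochs bounds the duel numbers that can influence `R`.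
  have hpeel : ∀ ω ω', (∀ i ∈ S, ∀ j ∈ S, i ≠ j → ∀ n < (Finset.Icc 1 (N - 1)).sup fun t =>
      UnchainedBandits.horizon (δ / N / (S.card : ℝ) ^ 2) (ε t), X i j n ω = X i j n ω') →
      R ω = R ω' ∧ R ω' ⊆ S := by
    intro ω ω' hωω'
    obtain ⟨p1, p2, -⟩ := UnchainedBandits.peel_spec B (y := fun i j n => X i j n ω) (hswap ω')
      horder rfl hβ0 hβ1 hanti hε0 (fun t ht i hi j hj hij n hn => hωω' i hi j hj hij n
        (hn.trans_le (Finset.le_sup (f := fun t =>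
          UnchainedBandits.horizon (δ / N / (S.card : ℝ) ^ 2) (ε t)) (Finset.mem_Icc.mpr ht))))
      (by positivity) (fun t ht => UnchainedBandits.div_pow_le_of_mul_sqrt_le (by linarith)
        (by linarith) hΔ (mul_nonneg zero_le_three hL) (hε t ht)) (N - 1) le_rfl
    exact ⟨congrArg Prod.fst p1, p2⟩
  have hdirect := hX.measureReal_direct_failure_le hS hδ hδ1 hN hε0
  have hdecoy := hX.measureReal_decoy_failure_le hδ hδ1 hΔ hd hN (R := R)
    (fun ω => (hpeel ω ω fun _ _ _ _ _ _ _ => rfl).2) fun ω ω' h => (hpeel ω ω' h).1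
  set bad₁ := {ω | ∃ t ∈ Finset.Icc 1 (N - 1), ∃ p ∈ S.offDiag, ¬ UnchainedBandits.Concentrated B
    (fun i j n => X i j n ω) (δ / N / (S.card : ℝ) ^ 2) (ε t) p.1 p.2} with hbad₁
  set bad₂ := {ω | ∃ p ∈ (R ω).offDiag, ¬ UnchainedBandits.Concentrated B
    (fun i j n => X i j n ω) (δ / N / ((R ω).card : ℝ) ^ 2 / 2) Δ p.1 (d p.2)} with hbad₂
  set good := {ω |
    (UnchainedBandits.unchainedBandits (fun i j n => X i j n ω) order d S δ Δ N ε).1 =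
        UnchainedBandits.paretoFront S ∧
    (UnchainedBandits.totalPulls (UnchainedBandits.unchainedBandits
        (fun i j n => X i j n ω) order d S δ Δ N ε).2 : ℝ) ≤
      18 * ((S.card : ℝ) * (UnchainedBandits.width S : ℝ) *
        Real.log ((N : ℝ) * (S.card : ℝ) ^ 2 / δ) / Δ ^ 2)} with hgood
  -- Covering the whole space needs only subadditivity, so `good` need not be shown measurable.
  have hcover : Set.univ ⊆ good ∪ (bad₁ ∪ bad₂) := by
    intro ω _
    by_cases h1 : ω ∈ bad₁
    · exact Or.inr (Or.inl h1)
    by_cases h2 : ω ∈ bad₂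
    · exact Or.inr (Or.inr h2)
    refine Or.inl (UnchainedBandits.unchainedBandits_correct hS hδ hδ1 hΔ hd hN hanti hε horder
      (hswap ω) (fun t ht i hi j hj hij => ?_) fun i hi j hj hij => ?_)
    · by_contra hc
      exact h1 ⟨t, Finset.mem_Icc.mpr ht, (i, j), Finset.mem_offDiag.mpr ⟨hi, hj, hij⟩, hc⟩
    · by_contra hc
      exact h2 ⟨(i, j), Finset.mem_offDiag.mpr ⟨hi, hj, hij⟩, hc⟩
  have htotal : 1 ≤ μ.real good + (μ.real bad₁ + μ.real bad₂) := by
    calc (1 : ℝ) = μ.real Set.univ := MeasureTheory.probReal_univ.symm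
      _ ≤ μ.real (good ∪ (bad₁ ∪ bad₂)) := MeasureTheory.measureReal_mono hcover
      _ ≤ μ.real good + μ.real (bad₁ ∪ bad₂) := MeasureTheory.measureReal_union_le _ _
      _ ≤ _ := by gcongr; exact MeasureTheory.measureReal_union_le _ _
  have hsum : ((N : ℝ) - 1) * (δ / N) + δ / N = δ := by
    field_simp
    ring
  linarith
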